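/- Let $0<\varepsilon<T$, let $f:[0,T]\to[0,\infty)$ and $g:[0,T]\to(0,\infty)$ be continuous, and let $p_0=\frac1{|\mathcal I|}\sum_{i\in\mathcal I}\delta_{x_0^i}$ be the uniform distribution on a finite non-empty family of points of $\mathbb R^n$. Let $(x(t))_{t\in[0,T]}$ solve the stochastic differential equation $dx=-f(t)\,x\,dt+g(t)\,dW_t$, $x(0)\sim p_0$, where $W$ is an $n$-dimensional standard Wiener process independent of $x(0)$, and let $p_t$ denote the law of $x(t)$ and, for $t>0$, also its continuous Lebesgue density. Let $S_\theta:\mathbb R^n\times[\varepsilon,T]\to\mathbb R^n$ be a measurable function (the learned score) such that $$\|S_\theta(x,t)-S_\theta(y,t)\|_2\le L_{S_\theta}(t)\,\|x-y\|_2\qquad(x,y\in\mathbb R^n,\ t\in[\varepsilon,T]),$$ where $L_{S_\theta}$ is continuous on $[\varepsilon,T]$ and is extended to $[0,\varepsilon)$ by an arbitrary integrable function. Let $M_{ot}^{T,\varepsilon}$ be the map that sends each $x\in\mathbb R^n$ to $x_\varepsilon$, where $(x_t)_{t\in[\varepsilon,T]}$ solves the probability flow equation $$\frac{dx_t}{dt}=-f(t)x_t-\frac{g(t)^2}{2}\nabla\log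 p_t(x_t),\qquad x_T=x,$$ and let $M_\theta^{T,\varepsilon}$ be the corresponding map for the equation in which $\nabla\log p_t$ is replaced by $S_\theta(\cdot,t)$; both are assumed to be defined on all of $\mathbb R^n$. Put $$I(t)=\exp\Big(\int_0^t\Big(f(\tau)+\frac{g(\tau)^2}{2}L_{S_\theta}(\tau)\Big)d\tau\Big),\qquad \phi(t)=g(t)^4I(t)^2,$$ $$\mathcal J_{SM}(\theta,\phi,\varepsilon,T)=\frac12\int_\varepsilon^T\phi(t)\,\mathbb E_{x\sim p_t}\big[\|S_\theta(x,t)-\nabla\log p_t(x)\|_2^2\big]\,dt\in[0,\infty].$$ Then, with $q_T=p_T$, $$\big\|M_{ot}^{T,\varepsilon}-M_\theta^{T,\varepsilon}\big\|_{L_2(q_T)}\le\sqrt{\frac{T-\varepsilon}{2I(\varepsilon)^2}}\;\mathcal J_{SM}(\theta,\phi,\varepsilon,T)^{1/2}.$$ -/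

import Mathlib

open MeasureTheory ProbabilityTheory Filter Topology Set
open scoped NNReal ENNReal

noncomputable section

/-- `W` is an `n`-dimensional standard Wiener motion: its coordinates are independent
real Brownian motions (with almost surely continuous paths). -/
structure IsStandardWiener {n : ℕ} {Ω : Type*} [MeasurableSpace Ω]
    (W : ℝ≥0 → Ω → EuclideanSpace ℝ (Fin n)) (P : Measure Ω) : Prop where
  measurable : ∀ t, Measurable (W t)
  brownian : ∀ i : Fin n, IsBrownianReal (fun t ω => W t ω i) P
  indep : iIndepFun (fun (i : Fin n) (ω : Ω) (t : ℝ≥0) => W t ω i) P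

/-- The left-endpoint sum `∑_{k < m} g(kt/m) (W_{(k+1)t/m} - W_{kt/m})`. -/
def stochRiemannSum {n : ℕ} {Ω : Type*} (g : ℝ → ℝ)
    (W : ℝ≥0 → Ω → EuclideanSpace ℝ (Fin n)) (t : ℝ) (m : ℕ) (ω : Ω) :
    EuclideanSpace ℝ (Fin n) :=
  ∑ k ∈ Finset.range m, g ((k : ℝ) * t / m) •
    (W (Real.toNNReal (((k : ℝ) + 1) * t / m)) ω - W (Real.toNNReal ((k : ℝ) * t / m)) ω)

/-- `Z` is (a version of) the stochastic integral `∫₀ᵗ g(s) dW_s` of the deterministic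
integrand `g`, continuous on `[0,t]`: the limit in probability of the left-endpoint sums. -/
def IsItoIntegral {n : ℕ} {Ω : Type*} [MeasurableSpace Ω] (P : Measure Ω) (g : ℝ → ℝ)
    (W : ℝ≥0 → Ω → EuclideanSpace ℝ (Fin n)) (t : ℝ) (Z : Ω → EuclideanSpace ℝ (Fin n)) : Prop :=
  TendstoInMeasure P (fun m ω => stochRiemannSum g W t m ω) atTop Z

/-- `X` solves `dX = -f(t) X dt + g(t) dW` on `[0,T]` with initial law `p₀`, where `W` is a
standard Wiener motion independent of `X 0`: it has almost surely continuous paths and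
`X_t - X_0 + ∫₀ᵗ f(s) X_s ds = ∫₀ᵗ g(s) dW_s` for every `t ∈ [0,T]`. -/
structure IsForwardSolution {n : ℕ} {Ω : Type*} [MeasurableSpace Ω] (P : Measure Ω)
    (f g : ℝ → ℝ) (T : ℝ) (p₀ : Measure (EuclideanSpace ℝ (Fin n)))
    (W : ℝ≥0 → Ω → EuclideanSpace ℝ (Fin n)) (X : ℝ → Ω → EuclideanSpace ℝ (Fin n)) : Prop where
  wiener : IsStandardWiener W P
  measurable : ∀ t ∈ Icc 0 T, Measurable (X t)
  continuous_paths : ∀ᵐ ω ∂P, ContinuousOn (fun t => X t ω) (Icc 0 T)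
  initial_law : P.map (X 0) = p₀
  initial_indep : IndepFun (X 0) (fun (ω : Ω) (t : ℝ≥0) => W t ω) P
  equation : ∀ t ∈ Icc 0 T,
    IsItoIntegral P g W t (fun ω => X t ω - X 0 ω + ∫ s in (0 : ℝ)..t, f s • X s ω)

/-- The uniform distribution `|ι|⁻¹ ∑ᵢ δ_{xᵢ}` on a finite family of points. -/
def uniformDiscrete {n : ℕ} {ι : Type*} [Fintype ι] (x : ι → EuclideanSpace ℝ (Fin n)) :
    Measure (EuclideanSpace ℝ (Fin n)) :=
  (Fintype.card ι : ℝ≥0∞)⁻¹ • ∑ i, Measure.dirac (x i)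

/-- `p` is a continuous probability density (with respect to Lebesgue measure) of `ν`. -/
def IsContinuousDensity {n : ℕ} (ν : Measure (EuclideanSpace ℝ (Fin n)))
    (p : EuclideanSpace ℝ (Fin n) → ℝ) : Prop :=
  Continuous p ∧ (∀ x, 0 ≤ p x) ∧ ν = volume.withDensity (fun x => ENNReal.ofReal (p x))

open Classical in
/-- The continuous Lebesgue density of `ν` (the zero function if there is none). -/
def continuousDensity {n : ℕ} (ν : Measure (EuclideanSpace ℝ (Fin n))) :
    EuclideanSpace ℝ (Fin n) → ℝ :=
  if h : ∃ p, IsContinuousDensity ν p then h.choose else 0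

/-- The continuous density is unique, so the choice above is immaterial. -/
theorem continuousDensity_eq {n : ℕ} {ν : Measure (EuclideanSpace ℝ (Fin n))}
    [IsFiniteMeasure ν] {p : EuclideanSpace ℝ (Fin n) → ℝ} (hp : IsContinuousDensity ν p) :
    continuousDensity ν = p := by
  have h : ∃ p, IsContinuousDensity ν p := ⟨p, hp⟩
  have hq : IsContinuousDensity ν (continuousDensity ν) := by
    rw [continuousDensity, dif_pos h]; exact h.choose_spec
  obtain ⟨qc, q0, hqν⟩ := hq
  obtain ⟨pc, p0, hpν⟩ := hp
  have hae : (fun x => ENNReal.ofReal (continuousDensity ν x)) =ᵐ[volume]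
      fun x => ENNReal.ofReal (p x) := by
    rw [← withDensity_eq_iff_of_sigmaFinite (by fun_prop) (by fun_prop), ← hqν, ← hpν]
  refine (Continuous.ae_eq_iff_eq volume qc pc).1 ?_
  filter_upwards [hae] with x hx
  exact (ENNReal.ofReal_eq_ofReal_iff (q0 x) (p0 x)).1 hx

/-- The score `∇ log p` of a measure with continuous density `p`. -/
def score {n : ℕ} (ν : Measure (EuclideanSpace ℝ (Fin n))) (x : EuclideanSpace ℝ (Fin n)) :
    EuclideanSpace ℝ (Fin n) :=
  gradient (fun y => Real.log (continuousDensity ν y)) x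

/-- The velocity field `-f(t) x - (g(t)²/2) s(x,t)` driven by a score function `s`. -/
def flowVelocity {n : ℕ} (f g : ℝ → ℝ)
    (s : EuclideanSpace ℝ (Fin n) → ℝ → EuclideanSpace ℝ (Fin n))
    (t : ℝ) (x : EuclideanSpace ℝ (Fin n)) : EuclideanSpace ℝ (Fin n) :=
  -(f t • x) - (g t ^ 2 / 2) • s x t

/-- `M` is the solution map of `dx/dt = v(t,x)` from time `s` to time `t` (possibly `t < s`). -/
def IsSolutionMap {n : ℕ} (v : ℝ → EuclideanSpace ℝ (Fin n) → EuclideanSpace ℝ (Fin n))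
    (s t : ℝ) (M : EuclideanSpace ℝ (Fin n) → EuclideanSpace ℝ (Fin n)) : Prop :=
  ∀ x, ∃ γ : ℝ → EuclideanSpace ℝ (Fin n),
    IsIntegralCurveOn γ v (uIcc s t) ∧ γ s = x ∧ M x = γ t

/-- The weighted score matching loss
`(1/2) ∫_a^b φ(t) E_{x ~ p_t} ‖S(x,t) - ∇ log p_t(x)‖² dt`, with values in `[0,∞]`. -/
def scoreMatchingLoss {n : ℕ} (p : ℝ → Measure (EuclideanSpace ℝ (Fin n)))
    (S : EuclideanSpace ℝ (Fin n) → ℝ → EuclideanSpace ℝ (Fin n)) (φ : ℝ → ℝ) (a b : ℝ) : ℝ≥0∞ :=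
  2⁻¹ * ∫⁻ t in Icc a b, ENNReal.ofReal (φ t) * ∫⁻ x, ‖S x t - score (p t) x‖ₑ ^ 2 ∂(p t)

/-- The integrating factor `I(t) = exp (∫₀ᵗ (f(τ) + g(τ)²/2 · L(τ)) dτ)`. -/
def integratingFactor (f g L : ℝ → ℝ) (t : ℝ) : ℝ :=
  Real.exp (∫ τ in (0 : ℝ)..t, (f τ + g τ ^ 2 / 2 * L τ))

end

/-!
The marginals of the diffusion are explicit. Multiplying the equation by `exp (∫₀ᵗ f)` exhibits
`exp (∫₀ᵗ f) x(t) - x(0)` as a limit of linear combinations of values of the Wiener process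
(`tendsto_sum_inv_meanScale_smul`, `charFun_add_sum_increments`), so that the characteristic
function of `x(t)` is that of `m(t) x(0)` plus an independent centred Gaussian vector of covariance
`V(t)`, where `m' = -f m` and `V' = -2 f V + g²` (`IsForwardSolution.charFun_map`). For `t > 0` the
marginal is therefore a Gaussian mixture (`isContinuousDensity_mixDensity`), and its score is smooth
in space, with a derivative bounded uniformly for `t ∈ [ε, T]` (`norm_mixScoreDeriv_le`).

The mixture density solves the continuity equation of the probability flow
(`hasDerivWithinAt_mixDensity_comp`). By Liouville's theorem the flow, run backwards from time `T`,
carries `p T` to `p t`. Only the inequality `∫ F (x_t) dp_T ≤ ∫ F dp_t` for `F ≥ 0` is needed, and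
it holds without knowing that the flow is onto (`lintegral_comp_flow_le`,
`lintegral_comp_probabilityFlow_le`).

Let `x` and `y` be trajectories of the probability flow and of the learned flow which agree at time
`T`. Since `S(·, t)` is `L(t)`-Lipschitz, `-d/dt |x - y|` is at most
`(f + g² L / 2) |x - y| + (g² / 2) |S(x, t) - ∇ log p_t(x)|`, whence
`I(ε) |x_ε - y_ε| ≤ ∫ I (g² / 2) |S(x_t, t) - ∇ log p_t(x_t)| dt` over `[ε, T]`
(`ofReal_mul_enorm_sub_le`). Squaring, using the Cauchy-Schwarz inequality in time, integrating
against `p T`, exchanging the integrals and transporting `p T` to `p t` gives the claim.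
-/

/-! ### Linear differential equations on a compact interval -/

section LinearODE

variable {F : Type*} [NormedAddCommGroup F] [NormedSpace ℝ F]

/-- The radial retraction of a normed space onto the closed ball of radius `R`. -/
noncomputable def radialRetraction (R : ℝ) (x : F) : F := (R / max R ‖x‖) • x

theorem norm_radialRetraction_le {R : ℝ} (hR : 0 < R) (x : F) : ‖radialRetraction R x‖ ≤ R := by
  have h : 0 < max R ‖x‖ := lt_max_of_lt_left hR
  rw [radialRetraction, norm_smul, Real.norm_of_nonneg (by positivity), div_mul_eq_mul_div,
    div_le_iff₀ h]
  gcongr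
  exact le_max_right _ _

theorem norm_radialRetraction_le_norm {R : ℝ} (hR : 0 < R) (x : F) :
    ‖radialRetraction R x‖ ≤ ‖x‖ := by
  have h : 0 < max R ‖x‖ := lt_max_of_lt_left hR
  rw [radialRetraction, norm_smul, Real.norm_of_nonneg (by positivity)]
  refine mul_le_of_le_one_left (norm_nonneg _) ?_
  rw [div_le_one h]
  exact le_max_left _ _

theorem radialRetraction_of_norm_le {R : ℝ} (hR : 0 < R) {x : F} (hx : ‖x‖ ≤ R) :
    radialRetraction R x = x := by
  rw [radialRetraction, max_eq_left hx, div_self hR.ne', one_smul]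

theorem lipschitzWith_radialRetraction {R : ℝ} (hR : 0 < R) :
    LipschitzWith 2 (radialRetraction R : F → F) := by
  refine LipschitzWith.of_dist_le_mul fun x y => ?_
  rw [dist_eq_norm, dist_eq_norm]
  have hx : 0 < max R ‖x‖ := lt_max_of_lt_left hR
  have hy : 0 < max R ‖y‖ := lt_max_of_lt_left hR
  have key : radialRetraction R x - radialRetraction R y =
      (R / max R ‖x‖) • (x - y) + (R / max R ‖x‖ - R / max R ‖y‖) • y := by
    simp only [radialRetraction, smul_sub, sub_smul]; abel
  have h1 : ‖(R / max R ‖x‖) • (x - y)‖ ≤ ‖x - y‖ := by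
    rw [norm_smul, Real.norm_of_nonneg (by positivity)]
    refine mul_le_of_le_one_left (norm_nonneg _) ?_
    rw [div_le_one hx]
    exact le_max_left _ _
  have h2 : ‖(R / max R ‖x‖ - R / max R ‖y‖) • y‖ ≤ ‖x - y‖ := by
    have h3 : |max R ‖y‖ - max R ‖x‖| ≤ ‖x - y‖ := by
      rw [max_comm R, max_comm R, norm_sub_rev]
      exact (abs_max_sub_max_le_abs ‖y‖ ‖x‖ R).trans (abs_norm_sub_norm_le y x)
    have h4 : R / max R ‖x‖ - R / max R ‖y‖ =
        (R / max R ‖x‖) * ((max R ‖y‖ - max R ‖x‖) / max R ‖y‖) := by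
      field_simp
    rw [norm_smul, h4, norm_mul, Real.norm_of_nonneg (by positivity : 0 ≤ R / max R ‖x‖),
      norm_div, Real.norm_of_nonneg hy.le, mul_assoc]
    have h5 : R / max R ‖x‖ ≤ 1 := (div_le_one hx).2 (le_max_left _ _)
    have h6 : ‖max R ‖y‖ - max R ‖x‖‖ / max R ‖y‖ * ‖y‖ ≤ ‖x - y‖ := by
      rw [div_mul_eq_mul_div, div_le_iff₀ hy]
      exact mul_le_mul h3 (le_max_right _ _) (norm_nonneg _) (norm_nonneg _)
    calc _ ≤ 1 * (‖max R ‖y‖ - max R ‖x‖‖ / max R ‖y‖ * ‖y‖) := by gcongr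
      _ ≤ _ := by rwa [one_mul]
  rw [key]
  refine (norm_add_le _ _).trans ?_
  push_cast
  linarith

/-- A linear equation with continuous coefficients has a solution on a whole compact interval:
composing the right-hand side with a radial retraction makes it bounded, so that the
Picard-Lindelöf theorem applies. -/
theorem exists_hasDerivWithinAt_linear [CompleteSpace F] {b : ℝ} (hb : 0 ≤ b) {A : ℝ → F →L[ℝ] F}
    (hA : ContinuousOn A (Icc 0 b)) (x₀ : F) :
    ∃ y : ℝ → F, y 0 = x₀ ∧ ∀ t ∈ Icc 0 b, HasDerivWithinAt y (A t (y t)) (Icc 0 b) t := by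
  obtain ⟨K, hK⟩ := isCompact_Icc.exists_bound_of_continuousOn hA
  have hK0 : 0 ≤ K := (norm_nonneg _).trans (hK 0 ⟨le_rfl, hb⟩)
  -- the a priori bound of Grönwall, so that the retraction is invisible to the solution
  set R : ℝ := (‖x₀‖ + 1) * Real.exp (K * b) with hR
  have hR0 : 0 < R := by positivity
  have hPL : IsPicardLindelof (fun t x => A t (radialRetraction R x)) (tmin := 0) (tmax := b)
      ⟨0, le_rfl, hb⟩ x₀ ⟨K * R * b, by positivity⟩ 0 ⟨K * R, by positivity⟩ (⟨K, hK0⟩ * 2) := by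
    refine ⟨fun t ht => ?_, fun x _ => ?_, fun t ht x _ => ?_, ?_⟩
    · refine LipschitzWith.lipschitzOnWith ?_
      refine LipschitzWith.comp ?_ (lipschitzWith_radialRetraction hR0)
      exact (A t).lipschitz.weaken (hK t ht)
    · exact hA.clm_apply continuousOn_const
    · exact ((A t).le_opNorm _).trans
        (mul_le_mul (hK t ht) (norm_radialRetraction_le hR0 x) (norm_nonneg _) hK0)
    · change K * R * max (b - 0) (0 - 0) ≤ K * R * b - 0
      simp [hb]
  obtain ⟨y, hy0, hy⟩ := hPL.exists_eq_forall_mem_Icc_hasDerivWithinAt₀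
  refine ⟨y, hy0, fun t ht => ?_⟩
  have hyR : ‖y t‖ ≤ R := by
    have := norm_le_gronwallBound_of_norm_deriv_right_le (f := y) (δ := ‖x₀‖) (K := K) (ε := 0)
      (fun s hs => (hy s hs).continuousWithinAt)
      (fun s hs => (hy s ⟨hs.1, hs.2.le⟩).mono_of_mem_nhdsWithin (Icc_mem_nhdsGE_of_mem hs))
      (by simp only [hy0]; exact le_rfl) (fun s hs => ?_) t ht
    · rw [gronwallBound_ε0] at this
      refine this.trans ?_
      rw [hR]
      gcongr
      · linarith
      · linarith [ht.2]
    · rw [add_zero]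
      refine ((A s).le_opNorm _).trans ?_
      exact mul_le_mul (hK s ⟨hs.1, hs.2.le⟩) (norm_radialRetraction_le_norm hR0 _)
        (norm_nonneg _) hK0
  have := hy t ht
  rwa [radialRetraction_of_norm_le hR0 hyR] at this

end LinearODE

/-! ### Derivative of the determinant along a matrix equation -/

section Det

variable {E : Type*} [NormedAddCommGroup E] [NormedSpace ℝ E] [FiniteDimensional ℝ E]

theorem differentiable_clm_det : Differentiable ℝ (fun J : E →L[ℝ] E => J.det) := by
  let b := Module.finBasis ℝ E
  have h : (fun J : E →L[ℝ] E => J.det) = fun J : E →L[ℝ] E =>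
      ∑ σ : Equiv.Perm (Fin (Module.finrank ℝ E)), (Equiv.Perm.sign σ : ℝ) *
        ∏ i, LinearMap.toContinuousLinearMap (b.coord (σ i)) (J (b i)) := by
    ext J
    rw [ContinuousLinearMap.det, ← LinearMap.det_toMatrix b, Matrix.det_apply]
    refine Finset.sum_congr rfl fun σ _ => ?_
    rw [Units.smul_def, zsmul_eq_mul]
    simp [LinearMap.toMatrix_apply]
  rw [h]
  refine Differentiable.fun_sum fun σ _ => Differentiable.const_mul ?_ _
  fun_prop

/-- The logarithmic derivative of the determinant is the trace: in the direction `A ∘ J` the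
determinant at `J` changes at the rate `tr A * det J`, because
`det (J + h A J) = det (1 + h A) * det J`. No invertibility of `J` is needed. -/
theorem fderiv_clm_det_comp (A J : E →L[ℝ] E) :
    fderiv ℝ (fun J : E →L[ℝ] E => J.det) J (A ∘L J) = LinearMap.trace ℝ E A * J.det := by
  let b := Module.finBasis ℝ E
  have h1 : HasDerivAt (fun h : ℝ => (J + h • (A ∘L J)).det)
      (fderiv ℝ (fun J : E →L[ℝ] E => J.det) J (A ∘L J)) 0 := by
    have hl : HasDerivAt (fun h : ℝ => J + h • (A ∘L J)) (A ∘L J) 0 := by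
      simpa using ((hasDerivAt_id (0 : ℝ)).smul_const (A ∘L J)).const_add J
    have := (differentiable_clm_det (E := E) (J + (0 : ℝ) • (A ∘L J))).hasFDerivAt.comp_hasDerivAt
      (0 : ℝ) hl
    simpa [Function.comp_def] using this
  have h2 : HasDerivAt (fun h : ℝ => (J + h • (A ∘L J)).det) (LinearMap.trace ℝ E A * J.det) 0 := by
    set M := LinearMap.toMatrix b b (A : E →ₗ[ℝ] E) with hM
    have hdet : (fun h : ℝ => (J + h • (A ∘L J)).det) = fun h : ℝ =>
        (Matrix.det (1 + (Polynomial.X : Polynomial ℝ) • M.map Polynomial.C)).eval h * J.det := by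
      ext h
      have : J + h • (A ∘L J) = (1 + h • A) ∘L J := by ext; simp
      rw [this]
      have hc : ((1 + h • A) ∘L J).det = (1 + h • A).det * J.det := by
        simp only [ContinuousLinearMap.det, ContinuousLinearMap.toLinearMap_comp,
          LinearMap.det_comp]
      rw [hc]
      congr 1
      rw [ContinuousLinearMap.det, ← LinearMap.det_toMatrix b, ← Polynomial.coe_evalRingHom,
        RingHom.map_det]
      congr 1
      ext i j
      simp [hM, Matrix.one_apply, LinearMap.toMatrix_apply, Finsupp.single_apply, eq_comm]
      split_ifs <;> simp [mul_comm]
    rw [hdet]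
    have := (Polynomial.hasDerivAt (Matrix.det (1 + (Polynomial.X : Polynomial ℝ) •
      M.map Polynomial.C)) (0:ℝ)).mul_const J.det
    rw [Matrix.derivative_det_one_add_X_smul] at this
    rwa [LinearMap.trace_eq_matrix_trace ℝ b]
  exact h1.unique h2

theorem HasDerivWithinAt.clm_det {J : ℝ → E →L[ℝ] E} {A : E →L[ℝ] E} {s : Set ℝ} {t : ℝ}
    (hJ : HasDerivWithinAt J (A ∘L J t) s t) :
    HasDerivWithinAt (fun t => (J t).det) (LinearMap.trace ℝ E A * (J t).det) s t := by
  rw [← fderiv_clm_det_comp]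
  exact (differentiable_clm_det (E := E) (J t)).hasFDerivAt.comp_hasDerivWithinAt t hJ

end Det

/-! ### Liouville's theorem for a Lipschitz flow -/

section Liouville

variable {E : Type*} [NormedAddCommGroup E] [NormedSpace ℝ E]
  {b : ℝ} {v : ℝ → E → E} {v' : ℝ → E → E →L[ℝ] E} {K : ℝ≥0} {Φ : E → ℝ → E}

theorem HasDerivWithinAt.Ici_of_Icc {γ : ℝ → E} {γ' : E} {a b t : ℝ}
    (h : HasDerivWithinAt γ γ' (Icc a b) t) (ht : t ∈ Ico a b) : HasDerivWithinAt γ γ' (Ici t) t :=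
  h.mono_of_mem_nhdsWithin (Icc_mem_nhdsGE_of_mem ht)

theorem HasDerivWithinAt.Iic_of_Icc {γ : ℝ → E} {γ' : E} {a b t : ℝ}
    (h : HasDerivWithinAt γ γ' (Icc a b) t) (ht : t ∈ Ioc a b) : HasDerivWithinAt γ γ' (Iic t) t :=
  h.mono_of_mem_nhdsWithin (Icc_mem_nhdsLE_of_mem ht)

theorem IsIntegralCurveOn.continuousOn' {γ : ℝ → E} {s : Set ℝ} (h : IsIntegralCurveOn γ v s) :
    ContinuousOn γ s := fun t ht => (h t ht).continuousWithinAt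

theorem dist_flow_le (hK : ∀ t ∈ Icc 0 b, LipschitzWith K (v t))
    (hΦ : ∀ x, IsIntegralCurveOn (Φ x) v (Icc 0 b)) (hΦ0 : ∀ x, Φ x 0 = x)
    {t : ℝ} (ht : t ∈ Icc 0 b) (x y : E) :
    dist (Φ x t) (Φ y t) ≤ Real.exp (K * b) * dist x y := by
  have := dist_le_of_trajectories_ODE_of_mem (s := fun _ => univ) (δ := dist x y)
    (fun t ht => (hK t ⟨ht.1, ht.2.le⟩).lipschitzOnWith)
    (hΦ x).continuousOn' (fun t ht => ((hΦ x) t ⟨ht.1, ht.2.le⟩).Ici_of_Icc ht)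
    (fun _ _ => mem_univ _)
    (hΦ y).continuousOn' (fun t ht => ((hΦ y) t ⟨ht.1, ht.2.le⟩).Ici_of_Icc ht)
    (fun _ _ => mem_univ _) (by simp [hΦ0]) t ht
  refine this.trans ?_
  rw [mul_comm]
  gcongr
  linarith [ht.2]

theorem injective_flow (hK : ∀ t ∈ Icc 0 b, LipschitzWith K (v t))
    (hΦ : ∀ x, IsIntegralCurveOn (Φ x) v (Icc 0 b)) (hΦ0 : ∀ x, Φ x 0 = x)
    {t : ℝ} (ht : t ∈ Icc 0 b) : Function.Injective (fun x => Φ x t) := by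
  intro x y hxy
  have hsub : ∀ s ∈ Ioc 0 t, s ∈ Ioc 0 b := fun s hs => ⟨hs.1, hs.2.trans ht.2⟩
  have := ODE_solution_unique_of_mem_Icc_left (s := fun _ => univ) (a := 0) (b := t)
    (fun s hs => (hK s (Ioc_subset_Icc_self (hsub s hs))).lipschitzOnWith)
    ((hΦ x).continuousOn'.mono (Icc_subset_Icc_right ht.2))
    (fun s hs => ((hΦ x) s (Ioc_subset_Icc_self (hsub s hs))).Iic_of_Icc (hsub s hs))
    (fun _ _ => mem_univ _)
    ((hΦ y).continuousOn'.mono (Icc_subset_Icc_right ht.2))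
    (fun s hs => ((hΦ y) s (Ioc_subset_Icc_self (hsub s hs))).Iic_of_Icc (hsub s hs))
    (fun _ _ => mem_univ _) hxy
  have h0 := this ⟨le_rfl, ht.1⟩
  simpa [hΦ0] using h0

theorem gronwallBound_zero_mul (K c x : ℝ) :
    gronwallBound 0 K c x = c * gronwallBound 0 K 1 x := by
  unfold gronwallBound
  split_ifs <;> ring

/-- A solution of the variational equation along a trajectory is the space derivative of the
flow. -/
theorem hasFDerivAt_flow (hb : 0 ≤ b)
    (hv : ∀ t ∈ Icc 0 b, ∀ x, HasFDerivAt (v t) (v' t x) x)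
    (hv' : ContinuousOn (fun z : ℝ × E => v' z.1 z.2) (Icc 0 b ×ˢ univ))
    (hK : ∀ t ∈ Icc 0 b, LipschitzWith K (v t))
    (hΦ : ∀ x, IsIntegralCurveOn (Φ x) v (Icc 0 b)) (hΦ0 : ∀ x, Φ x 0 = x)
    {x : E} {J : ℝ → E →L[ℝ] E} (hJ0 : J 0 = 1)
    (hJ : ∀ t ∈ Icc 0 b, HasDerivWithinAt J (v' t (Φ x t) ∘L J t) (Icc 0 b) t)
    {t : ℝ} (ht : t ∈ Icc 0 b) : HasFDerivAt (fun y => Φ y t) (J t) x := by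
  set M := Real.exp (K * b) with hM
  have hM0 : 0 < M := Real.exp_pos _
  -- by compactness of the trajectory, `v'` is uniformly close to its value on the trajectory
  have huni : ∀ c > 0, ∃ δ > 0, ∀ s ∈ Icc 0 b, ∀ h : E, ‖h‖ < δ →
      ‖v' s (Φ x s + h) - v' s (Φ x s)‖ ≤ c := by
    intro c hc
    have key : ∀ s ∈ Icc 0 b, ∀ᶠ z in 𝓝 (0 : E) ×ˢ 𝓝[Icc 0 b] s,
        ‖v' z.2 (Φ x z.2 + z.1) - v' z.2 (Φ x z.2)‖ ≤ c := by
      intro s hs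
      have h1 : Tendsto (fun z : E × ℝ => z.2) (𝓝 (0 : E) ×ˢ 𝓝[Icc 0 b] s) (𝓝[Icc 0 b] s) :=
        tendsto_snd
      have h1' := h1.mono_right nhdsWithin_le_nhds
      have hm : ∀ᶠ z in 𝓝 (0 : E) ×ˢ 𝓝[Icc 0 b] s, z.2 ∈ Icc 0 b :=
        h1.eventually (eventually_mem_nhdsWithin)
      have h2 : Tendsto (fun z : E × ℝ => Φ x z.2) (𝓝 (0 : E) ×ˢ 𝓝[Icc 0 b] s) (𝓝 (Φ x s)) :=
        ((hΦ x).continuousOn' s hs).tendsto.comp h1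
      have h3 : Tendsto (fun z : E × ℝ => z.1) (𝓝 (0 : E) ×ˢ 𝓝[Icc 0 b] s) (𝓝 0) := tendsto_fst
      have h4 := h2.add h3
      rw [add_zero] at h4
      have hc' : ∀ {w : E × ℝ → E}, Tendsto w (𝓝 (0 : E) ×ˢ 𝓝[Icc 0 b] s) (𝓝 (Φ x s)) →
          Tendsto (fun z => v' z.2 (w z)) (𝓝 (0 : E) ×ˢ 𝓝[Icc 0 b] s) (𝓝 (v' s (Φ x s))) := by
        intro w hw
        have := (hv' (s, Φ x s) ⟨hs, mem_univ _⟩).tendsto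
        refine this.comp (f := fun z : E × ℝ => (z.2, w z)) ?_
        refine tendsto_nhdsWithin_iff.2 ⟨h1'.prodMk_nhds hw, ?_⟩
        filter_upwards [hm] with z hz using ⟨hz, mem_univ _⟩
      have h5 := ((hc' h4).sub (hc' h2)).norm
      rw [sub_self, norm_zero] at h5
      exact h5.eventually (Iic_mem_nhds hc)
    have hall : ∀ᶠ h in 𝓝 (0 : E), ∀ s ∈ Icc 0 b, s ∈ Icc 0 b →
        ‖v' s (Φ x s + h) - v' s (Φ x s)‖ ≤ c := by
      refine isCompact_Icc.eventually_forall_of_forall_eventually fun s hs => ?_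
      have h := key s hs
      rw [← nhdsWithin_univ (0 : E), ← nhdsWithin_prod_eq, eventually_nhdsWithin_iff] at h
      filter_upwards [h] with z hz hz2 using hz ⟨mem_univ _, hz2⟩
    obtain ⟨δ, hδ, h⟩ := Metric.eventually_nhds_iff.1 hall
    exact ⟨δ, hδ, fun s hs w hw => h (by simpa using hw) s hs hs⟩
  rw [hasFDerivAt_iff_isLittleO]
  refine Asymptotics.isLittleO_iff.2 fun c hc => ?_
  set G := gronwallBound 0 K 1 b with hG
  have hGnn : 0 ≤ G := by
    have := gronwallBound_mono (le_refl (0:ℝ)) (zero_le_one) K.2 hb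
    rwa [gronwallBound_x0] at this
  obtain ⟨δ, hδ, hδ'⟩ := huni (c / (M * (G + 1))) (by positivity)
  filter_upwards [Metric.ball_mem_nhds x (div_pos hδ hM0)] with y hy
  have hdist : ∀ s ∈ Icc 0 b, ‖Φ y s - Φ x s‖ ≤ M * ‖y - x‖ := fun s hs => by
    simpa [dist_eq_norm] using dist_flow_le hK hΦ hΦ0 hs y x
  have hsmall : M * ‖y - x‖ < δ := by
    rw [Metric.mem_ball, dist_eq_norm, lt_div_iff₀ hM0] at hy
    linarith
  set e : ℝ → E := fun s => Φ y s - Φ x s - J s (y - x) with he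
  have hder : ∀ s ∈ Icc 0 b, HasDerivWithinAt e
      (v s (Φ y s) - v s (Φ x s) - v' s (Φ x s) (J s (y - x))) (Icc 0 b) s := by
    intro s hs
    exact ((hΦ y s hs).sub (hΦ x s hs)).sub (by
      simpa using (hJ s hs).clm_apply (hasDerivWithinAt_const s (Icc 0 b) (y - x)))
  have hgr := norm_le_gronwallBound_of_norm_deriv_right_le (f := e) (δ := 0) (K := K)
    (ε := c / (M * (G + 1)) * (M * ‖y - x‖))
    (fun s hs => (hder s hs).continuousWithinAt)
    (fun s hs => (hder s ⟨hs.1, hs.2.le⟩).Ici_of_Icc hs)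
    (by simp [he, hΦ0, hJ0]) (fun s hs => ?_) t ht
  · rw [gronwallBound_zero_mul] at hgr
    have h1 : gronwallBound 0 K 1 (t - 0) ≤ G :=
      gronwallBound_mono le_rfl zero_le_one K.2 (by linarith [ht.2])
    have hnn : 0 ≤ c / (M * (G + 1)) * (M * ‖y - x‖) := by positivity
    calc ‖Φ y t - Φ x t - J t (y - x)‖ ≤ c / (M * (G + 1)) * (M * ‖y - x‖) * G :=
          hgr.trans (mul_le_mul_of_nonneg_left h1 hnn)
      _ = c * ‖y - x‖ * (G / (G + 1)) := by field_simp
      _ ≤ c * ‖y - x‖ * 1 := by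
          refine mul_le_mul_of_nonneg_left ?_ (by positivity)
          exact (div_le_one (by positivity)).2 (by linarith)
      _ = _ := mul_one _
  · have hs' : s ∈ Icc 0 b := ⟨hs.1, hs.2.le⟩
    have hrem : ‖v s (Φ y s) - v s (Φ x s) - v' s (Φ x s) (Φ y s - Φ x s)‖ ≤
        c / (M * (G + 1)) * ‖Φ y s - Φ x s‖ := by
      refine (convex_ball (Φ x s) δ).norm_image_sub_le_of_norm_hasFDerivWithin_le'
        (f' := fun z => v' s z) (fun z _ => (hv s hs' z).hasFDerivWithinAt) (fun z hz => ?_)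
        (Metric.mem_ball_self hδ) ?_
      · have := hδ' s hs' (z - Φ x s) (by rwa [Metric.mem_ball, dist_eq_norm] at hz)
        rwa [add_sub_cancel] at this
      · rw [Metric.mem_ball, dist_eq_norm]
        exact (hdist s hs').trans_lt hsmall
    have hop : ‖v' s (Φ x s)‖ ≤ K := (hv s hs' _).le_of_lipschitz (hK s hs')
    have hdec : v s (Φ y s) - v s (Φ x s) - v' s (Φ x s) (J s (y - x)) =
        v' s (Φ x s) (e s) +
        (v s (Φ y s) - v s (Φ x s) - v' s (Φ x s) (Φ y s - Φ x s)) := by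
      simp only [he, map_sub]; abel
    rw [hdec]
    refine (norm_add_le _ _).trans (add_le_add ?_ ?_)
    · exact ((v' s (Φ x s)).le_opNorm _).trans (by gcongr)
    · refine hrem.trans ?_
      gcongr
      exact hdist s hs'

/-- **Liouville's theorem** (as an inequality): if `ρ` solves the continuity equation along the
trajectories of `v`, then the flow of `v` carries the measure with density `ρ 0` into the measure
with density `ρ t`. The reverse inequality would require the flow to be onto. -/
theorem lintegral_comp_flow_le [FiniteDimensional ℝ E] [MeasurableSpace E] [BorelSpace E]
    (μ : Measure E) [μ.IsAddHaarMeasure] (hb : 0 ≤ b)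
    (hv : ∀ t ∈ Icc 0 b, ∀ x, HasFDerivAt (v t) (v' t x) x)
    (hv' : ContinuousOn (fun z : ℝ × E => v' z.1 z.2) (Icc 0 b ×ˢ univ))
    (hK : ∀ t ∈ Icc 0 b, LipschitzWith K (v t))
    (hΦ : ∀ x, IsIntegralCurveOn (Φ x) v (Icc 0 b)) (hΦ0 : ∀ x, Φ x 0 = x)
    {ρ : ℝ → E → ℝ} (hρ0 : ∀ t ∈ Icc 0 b, ∀ x, 0 ≤ ρ t x)
    (hρ : ∀ x, ∀ t ∈ Icc 0 b, HasDerivWithinAt (fun s => ρ s (Φ x s))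
      (-LinearMap.trace ℝ E (v' t (Φ x t)) * ρ t (Φ x t)) (Icc 0 b) t)
    {t : ℝ} (ht : t ∈ Icc 0 b) (F : E → ℝ≥0∞) :
    ∫⁻ x, F (Φ x t) * ENNReal.ofReal (ρ 0 x) ∂μ ≤ ∫⁻ x, F x * ENNReal.ofReal (ρ t x) ∂μ := by
  have hJex : ∀ x, ∃ J : ℝ → E →L[ℝ] E, J 0 = 1 ∧
      ∀ t ∈ Icc 0 b, HasDerivWithinAt J (v' t (Φ x t) ∘L J t) (Icc 0 b) t := by
    intro x
    have hA : ContinuousOn (fun t => v' t (Φ x t)) (Icc 0 b) :=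
      hv'.comp (f := fun t => (t, Φ x t)) (continuousOn_id.prodMk (hΦ x).continuousOn')
        fun s hs => ⟨hs, mem_univ _⟩
    exact exists_hasDerivWithinAt_linear hb
      (A := fun t => ContinuousLinearMap.compL ℝ E E E (v' t (Φ x t)))
      ((ContinuousLinearMap.compL ℝ E E E).continuous.comp_continuousOn hA) 1
  choose J hJ0 hJ using hJex
  have hfd : ∀ x, HasFDerivAt (fun y => Φ y t) (J x t) x := fun x =>
    hasFDerivAt_flow hb hv hv' hK hΦ hΦ0 (hJ0 x) (hJ x) ht
  have hconst : ∀ x, (J x t).det * ρ t (Φ x t) = ρ 0 x := by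
    intro x
    have hd : ∀ s ∈ Icc 0 b,
        HasDerivWithinAt (fun s => (J x s).det * ρ s (Φ x s)) 0 (Icc 0 b) s := by
      intro s hs
      have := ((hJ x s hs).clm_det).mul (hρ x s hs)
      refine this.congr_deriv ?_
      ring
    have := constant_of_has_deriv_right_zero (f := fun s => (J x s).det * ρ s (Φ x s))
      (fun s hs => (hd s hs).continuousWithinAt)
      (fun s hs => (hd s ⟨hs.1, hs.2.le⟩).Ici_of_Icc hs) t ht
    simpa [hJ0, hΦ0, ContinuousLinearMap.det] using this
  have himage := lintegral_image_eq_lintegral_abs_det_fderiv_mul μ MeasurableSet.univ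
    (fun x _ => (hfd x).hasFDerivWithinAt) (injective_flow hK hΦ hΦ0 ht).injOn
    (fun x => F x * ENNReal.ofReal (ρ t x))
  rw [setLIntegral_univ] at himage
  calc ∫⁻ x, F (Φ x t) * ENNReal.ofReal (ρ 0 x) ∂μ
      ≤ ∫⁻ x, ENNReal.ofReal |(J x t).det| * (F (Φ x t) * ENNReal.ofReal (ρ t (Φ x t))) ∂μ := by
        refine lintegral_mono fun x => ?_
        rw [mul_left_comm, ← ENNReal.ofReal_mul (abs_nonneg _)]
        gcongr
        rw [← hconst x]
        exact mul_le_mul_of_nonneg_right (le_abs_self _) (hρ0 t ht _)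
    _ = ∫⁻ x in (fun y => Φ y t) '' univ, F x * ENNReal.ofReal (ρ t x) ∂μ := himage.symm
    _ ≤ _ := setLIntegral_le_lintegral _ _

end Liouville

/-! ### Isotropic Gaussian mixtures -/

noncomputable section GaussianMixture

open scoped RealInnerProductSpace

variable {n : ℕ} {ι : Type*} [Fintype ι]

/-- The density at `y` of the centred Gaussian law on `ℝⁿ` with covariance `V • 1`. -/
def gaussKernel (V : ℝ) (y : EuclideanSpace ℝ (Fin n)) : ℝ :=
  (2 * Real.pi * V) ^ (-(n : ℝ) / 2) * Real.exp (-‖y‖ ^ 2 / (2 * V))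

theorem gaussKernel_pos {V : ℝ} (hV : 0 < V) (y : EuclideanSpace ℝ (Fin n)) :
    0 < gaussKernel V y := by
  unfold gaussKernel; positivity

variable (x₀ : ι → EuclideanSpace ℝ (Fin n))

/-- The sum of the densities of the Gaussian laws with means `m • x₀ i` and covariance `V • 1`. -/
def mixSum (m V : ℝ) (x : EuclideanSpace ℝ (Fin n)) : ℝ := ∑ i, gaussKernel V (x - m • x₀ i)

/-- The density of the uniform mixture of the Gaussian laws with means `m • x₀ i` and
covariance `V • 1`. -/
def mixDensity (m V : ℝ) (x : EuclideanSpace ℝ (Fin n)) : ℝ :=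
  (Fintype.card ι : ℝ)⁻¹ * mixSum x₀ m V x

/-- The score `∇ log` of the `i`-th component of the mixture. -/
def componentScore (m V : ℝ) (i : ι) (x : EuclideanSpace ℝ (Fin n)) : EuclideanSpace ℝ (Fin n) :=
  V⁻¹ • (m • x₀ i - x)

/-- The score of the mixture: the average of the scores of the components, with their posterior
probabilities as weights. -/
def mixScore (m V : ℝ) (x : EuclideanSpace ℝ (Fin n)) : EuclideanSpace ℝ (Fin n) :=
  (mixSum x₀ m V x)⁻¹ • ∑ i, gaussKernel V (x - m • x₀ i) • componentScore x₀ m V i x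

/-- The derivative of the score of the mixture: the posterior covariance of the scores of the
components, minus `V⁻¹`. -/
def mixScoreDeriv (m V : ℝ) (x : EuclideanSpace ℝ (Fin n)) :
    EuclideanSpace ℝ (Fin n) →L[ℝ] EuclideanSpace ℝ (Fin n) :=
  (mixSum x₀ m V x)⁻¹ • (∑ i, gaussKernel V (x - m • x₀ i) •
      InnerProductSpace.rankOne ℝ (componentScore x₀ m V i x) (componentScore x₀ m V i x))
    - V⁻¹ • ContinuousLinearMap.id ℝ _
    - InnerProductSpace.rankOne ℝ (mixScore x₀ m V x) (mixScore x₀ m V x)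

variable {x₀} {m V : ℝ}

theorem mixSum_pos [Nonempty ι] (hV : 0 < V) (x : EuclideanSpace ℝ (Fin n)) :
    0 < mixSum x₀ m V x :=
  Finset.sum_pos (fun _ _ => gaussKernel_pos hV _) Finset.univ_nonempty

theorem mixDensity_pos [Nonempty ι] (hV : 0 < V) (x : EuclideanSpace ℝ (Fin n)) :
    0 < mixDensity x₀ m V x :=
  mul_pos (by positivity) (mixSum_pos hV x)

theorem mixSum_smul_mixScore [Nonempty ι] (hV : 0 < V) (x : EuclideanSpace ℝ (Fin n)) :
    mixSum x₀ m V x • mixScore x₀ m V x =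
      ∑ i, gaussKernel V (x - m • x₀ i) • componentScore x₀ m V i x := by
  rw [mixScore, smul_smul, mul_inv_cancel₀ (mixSum_pos hV x).ne', one_smul]

theorem hasFDerivAt_gaussKernel_sub {ι : Type*} {x₀ : ι → EuclideanSpace ℝ (Fin n)} (hV : 0 < V)
    (i : ι) (x : EuclideanSpace ℝ (Fin n)) :
    HasFDerivAt (fun x => gaussKernel V (x - m • x₀ i))
      (gaussKernel V (x - m • x₀ i) • innerSL ℝ (componentScore x₀ m V i x)) x := by
  have h1 : HasFDerivAt (fun x : EuclideanSpace ℝ (Fin n) => ‖x - m • x₀ i‖ ^ 2)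
      (2 • innerSL ℝ (x - m • x₀ i)) x := by
    simpa using ((hasFDerivAt_id x).sub_const (m • x₀ i)).norm_sq
  have h2 := ((h1.neg.mul_const (2 * V)⁻¹).exp).const_mul ((2 * Real.pi * V) ^ (-(n : ℝ) / 2))
  simp only [← div_eq_mul_inv] at h2
  refine h2.congr_fderiv ?_
  ext k
  simp [gaussKernel, componentScore]
  field_simp
  ring

theorem hasFDerivAt_mixSum [Nonempty ι] (hV : 0 < V) (x : EuclideanSpace ℝ (Fin n)) :
    HasFDerivAt (mixSum x₀ m V) (mixSum x₀ m V x • innerSL ℝ (mixScore x₀ m V x)) x := by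
  refine (HasFDerivAt.fun_sum fun i _ => hasFDerivAt_gaussKernel_sub (x₀ := x₀) (m := m) hV i x
    ).congr_fderiv ?_
  rw [← map_smul, mixSum_smul_mixScore hV, map_sum]
  simp

theorem hasGradientAt_log_mixDensity [Nonempty ι] (hV : 0 < V) (x : EuclideanSpace ℝ (Fin n)) :
    HasGradientAt (fun y => Real.log (mixDensity x₀ m V y)) (mixScore x₀ m V x) x := by
  rw [hasGradientAt_iff_hasFDerivAt]
  have h := ((hasFDerivAt_mixSum (x₀ := x₀) (m := m) hV x).const_mul
    (Fintype.card ι : ℝ)⁻¹).log (mixDensity_pos hV x).ne'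
  refine h.congr_fderiv ?_
  ext k
  have := (mixSum_pos (x₀ := x₀) (m := m) hV x).ne'
  have hc : (Fintype.card ι : ℝ) ≠ 0 := by positivity
  simp
  field_simp

theorem hasFDerivAt_mixScore [Nonempty ι] (hV : 0 < V) (x : EuclideanSpace ℝ (Fin n)) :
    HasFDerivAt (mixScore x₀ m V) (mixScoreDeriv x₀ m V x) x := by
  have hQ := (mixSum_pos (x₀ := x₀) (m := m) hV x).ne'
  have h1 := (hasDerivAt_inv hQ).comp_hasFDerivAt x (hasFDerivAt_mixSum (x₀ := x₀) (m := m) hV x)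
  have h2 : ∀ i, HasFDerivAt (componentScore x₀ m V i) (-V⁻¹ • ContinuousLinearMap.id ℝ _) x :=
    fun i => (((hasFDerivAt_id x).const_sub (m • x₀ i)).const_smul V⁻¹).congr_fderiv (by ext; simp)
  have h3 := HasFDerivAt.fun_sum (u := Finset.univ) fun i _ =>
    (hasFDerivAt_gaussKernel_sub (x₀ := x₀) (m := m) hV i x).fun_smul (h2 i)
  refine (h1.smul h3).congr_fderiv ?_
  ext1 k
  have hs : ∑ i, gaussKernel V (x - m • x₀ i) • V⁻¹ • k = mixSum x₀ m V x • V⁻¹ • k := by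
    rw [mixSum, Finset.sum_smul]
  simp only [mixScoreDeriv, _root_.add_apply, _root_.sub_apply,
    _root_.smul_apply, _root_.sum_apply, Finset.sum_add_distrib,
    ContinuousLinearMap.smulRight_apply, InnerProductSpace.rankOne_apply, smul_add,
    ← mixSum_smul_mixScore hV, neg_smul, smul_neg, _root_.neg_apply,
    Finset.sum_neg_distrib, hs, ContinuousLinearMap.id_apply, Function.comp_apply,
    innerSL_apply_apply, smul_eq_mul, mul_smul, inv_smul_smul₀ hQ]
  have h4 : (mixSum x₀ m V x ^ 2)⁻¹ • mixSum x₀ m V x • ⟪mixScore x₀ m V x, k⟫ •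
      mixSum x₀ m V x • mixScore x₀ m V x = ⟪mixScore x₀ m V x, k⟫ • mixScore x₀ m V x := by
    simp only [smul_smul]
    congr 1
    field_simp
  rw [h4]
  abel

theorem trace_mixScoreDeriv (x : EuclideanSpace ℝ (Fin n)) :
    LinearMap.trace ℝ _ (mixScoreDeriv x₀ m V x : EuclideanSpace ℝ (Fin n) →ₗ[ℝ] _) =
      (mixSum x₀ m V x)⁻¹ * (∑ i, gaussKernel V (x - m • x₀ i) * ‖componentScore x₀ m V i x‖ ^ 2)
        - n / V - ‖mixScore x₀ m V x‖ ^ 2 := by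
  simp [mixScoreDeriv, InnerProductSpace.trace_rankOne, div_eq_inv_mul]

/-- The posterior covariance does not depend on a common shift of the scores of the components;
shifting by `x / V` makes them bounded in `x`. -/
theorem norm_mixScoreDeriv_le [Nonempty ι] (hV : 0 < V) {R : ℝ} (hR : ∀ i, ‖x₀ i‖ ≤ R)
    (x : EuclideanSpace ℝ (Fin n)) :
    ‖mixScoreDeriv x₀ m V x‖ ≤ 2 * (|m| * R / V) ^ 2 + 1 / V := by
  have hQ := mixSum_pos (x₀ := x₀) (m := m) hV x
  have hR0 : 0 ≤ R := (norm_nonneg _).trans (hR (Classical.arbitrary ι))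
  set B := |m| * R / V with hB
  have hB0 : 0 ≤ B := by positivity
  set c : EuclideanSpace ℝ (Fin n) := V⁻¹ • x with hc
  have hu : ∀ i, ‖componentScore x₀ m V i x + c‖ ≤ B := by
    intro i
    have : componentScore x₀ m V i x + c = V⁻¹ • m • x₀ i := by
      simp [componentScore, hc, smul_sub]
    rw [this, norm_smul, norm_smul, Real.norm_eq_abs, Real.norm_eq_abs, abs_inv, abs_of_pos hV, hB,
      div_eq_inv_mul]
    gcongr
    exact hR i
  have havg : ∀ (z : ι → EuclideanSpace ℝ (Fin n)) (C : ℝ), (∀ i, ‖z i‖ ≤ C) →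
      ‖(mixSum x₀ m V x)⁻¹ • ∑ i, gaussKernel V (x - m • x₀ i) • z i‖ ≤ C := by
    intro z C hz
    rw [norm_smul, norm_inv, Real.norm_of_nonneg hQ.le, inv_mul_le_iff₀ hQ, mixSum,
      Finset.sum_mul]
    refine norm_sum_le_of_le _ fun i _ => ?_
    rw [norm_smul, Real.norm_of_nonneg (gaussKernel_pos hV _).le]
    exact mul_le_mul_of_nonneg_left (hz i) (gaussKernel_pos hV _).le
  have hsc : mixScore x₀ m V x + c = (mixSum x₀ m V x)⁻¹ •
      ∑ i, gaussKernel V (x - m • x₀ i) • (componentScore x₀ m V i x + c) := by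
    simp only [smul_add, Finset.sum_add_distrib, ← Finset.sum_smul]
    rw [← mixSum, inv_smul_smul₀ hQ.ne', mixScore]
  have hs : ‖mixScore x₀ m V x + c‖ ≤ B := by
    rw [hsc]
    exact havg _ _ hu
  refine ContinuousLinearMap.opNorm_le_bound _ (by positivity) fun k => ?_
  have key : mixScoreDeriv x₀ m V x k =
      (mixSum x₀ m V x)⁻¹ • (∑ i, gaussKernel V (x - m • x₀ i) •
        ⟪componentScore x₀ m V i x + c, k⟫ • (componentScore x₀ m V i x + c))
      - V⁻¹ • k - ⟪mixScore x₀ m V x + c, k⟫ • (mixScore x₀ m V x + c) := by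
    have e1 : ∑ i, gaussKernel V (x - m • x₀ i) •
        ⟪componentScore x₀ m V i x + c, k⟫ • (componentScore x₀ m V i x + c) =
        (∑ i, gaussKernel V (x - m • x₀ i) •
          ⟪componentScore x₀ m V i x, k⟫ • componentScore x₀ m V i x)
        + mixSum x₀ m V x • (⟪mixScore x₀ m V x, k⟫ • c + ⟪c, k⟫ • mixScore x₀ m V x
          + ⟪c, k⟫ • c) := by
      have e2 : mixSum x₀ m V x * ⟪mixScore x₀ m V x, k⟫ =
          ∑ i, gaussKernel V (x - m • x₀ i) * ⟪componentScore x₀ m V i x, k⟫ := by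
        rw [← real_inner_smul_left, mixSum_smul_mixScore hV, sum_inner]
        simp only [real_inner_smul_left]
      have e3 : mixSum x₀ m V x • ⟪mixScore x₀ m V x, k⟫ • c =
          ∑ i, gaussKernel V (x - m • x₀ i) • ⟪componentScore x₀ m V i x, k⟫ • c := by
        rw [smul_smul, e2, Finset.sum_smul]
        simp only [mul_smul]
      have e4 : mixSum x₀ m V x • ⟪c, k⟫ • mixScore x₀ m V x =
          ∑ i, gaussKernel V (x - m • x₀ i) • ⟪c, k⟫ • componentScore x₀ m V i x := by
        rw [smul_comm, mixSum_smul_mixScore hV, Finset.smul_sum]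
        exact Finset.sum_congr rfl fun i _ => smul_comm _ _ _
      have e5 : mixSum x₀ m V x • ⟪c, k⟫ • c =
          ∑ i, gaussKernel V (x - m • x₀ i) • ⟪c, k⟫ • c := by
        rw [mixSum, Finset.sum_smul]
      rw [smul_add, smul_add, e3, e4, e5, ← Finset.sum_add_distrib, ← Finset.sum_add_distrib,
        ← Finset.sum_add_distrib]
      refine Finset.sum_congr rfl fun i _ => ?_
      simp only [inner_add_left, add_smul, smul_add]
      abel
    rw [e1, smul_add, inv_smul_smul₀ hQ.ne']
    simp only [mixScoreDeriv, _root_.sub_apply, _root_.smul_apply,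
      _root_.sum_apply, InnerProductSpace.rankOne_apply, ContinuousLinearMap.id_apply,
      inner_add_left, add_smul, smul_add]
    abel
  have hrank : ∀ z : EuclideanSpace ℝ (Fin n), ‖z‖ ≤ B → ‖⟪z, k⟫ • z‖ ≤ B ^ 2 * ‖k‖ := by
    intro z hz
    rw [norm_smul]
    calc ‖⟪z, k⟫‖ * ‖z‖ ≤ (‖z‖ * ‖k‖) * ‖z‖ := by gcongr; exact norm_inner_le_norm _ _
      _ ≤ (B * ‖k‖) * B := by gcongr
      _ = _ := by ring
  have hn : ‖V⁻¹ • k‖ = 1 / V * ‖k‖ := by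
    rw [norm_smul, norm_inv, Real.norm_of_nonneg hV.le, one_div]
  rw [key]
  calc _ ≤ B ^ 2 * ‖k‖ + 1 / V * ‖k‖ + B ^ 2 * ‖k‖ :=
        (norm_sub_le _ _).trans (add_le_add ((norm_sub_le _ _).trans
          (add_le_add (havg _ _ fun i => hrank _ (hu i)) hn.le)) (hrank _ hs))
    _ = _ := by ring

section Continuity

variable {X : Type*} [TopologicalSpace X] {s : Set X} {m V : X → ℝ}
  {x : X → EuclideanSpace ℝ (Fin n)}

theorem ContinuousOn.gaussKernel (hV : ContinuousOn V s) (hx : ContinuousOn x s)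
    (h : ∀ z ∈ s, 0 < V z) : ContinuousOn (fun z => gaussKernel (V z) (x z)) s := by
  unfold _root_.gaussKernel
  refine ContinuousOn.mul ?_ ?_
  · refine ContinuousOn.rpow_const (by fun_prop) fun z hz => Or.inl ?_
    have := h z hz
    positivity
  · refine Real.continuous_exp.comp_continuousOn (ContinuousOn.div (by fun_prop) (by fun_prop) ?_)
    intro z hz
    have := h z hz
    positivity

theorem continuousOn_componentScore {ι : Type*} (x₀ : ι → EuclideanSpace ℝ (Fin n))
    (hm : ContinuousOn m s) (hV : ContinuousOn V s) (hx : ContinuousOn x s)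
    (h : ∀ z ∈ s, 0 < V z) (i : ι) :
    ContinuousOn (fun z => componentScore x₀ (m z) (V z) i (x z)) s :=
  (hV.inv₀ fun z hz => (h z hz).ne').smul ((hm.smul continuousOn_const).sub hx)

variable (x₀)

theorem continuousOn_mixSum (hm : ContinuousOn m s) (hV : ContinuousOn V s)
    (hx : ContinuousOn x s) (h : ∀ z ∈ s, 0 < V z) :
    ContinuousOn (fun z => mixSum x₀ (m z) (V z) (x z)) s :=
  continuousOn_finsetSum _ fun _ _ => hV.gaussKernel (hx.sub (hm.smul continuousOn_const)) h

theorem continuousOn_mixScore [Nonempty ι] (hm : ContinuousOn m s) (hV : ContinuousOn V s)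
    (hx : ContinuousOn x s) (h : ∀ z ∈ s, 0 < V z) :
    ContinuousOn (fun z => mixScore x₀ (m z) (V z) (x z)) s :=
  ((continuousOn_mixSum x₀ hm hV hx h).inv₀ fun z hz => (mixSum_pos (h z hz) _).ne').smul
    (continuousOn_finsetSum _ fun _ _ =>
      (hV.gaussKernel (hx.sub (hm.smul continuousOn_const)) h).smul
        (continuousOn_componentScore x₀ hm hV hx h _))

theorem ContinuousOn.rankOne_self (hx : ContinuousOn x s) :
    ContinuousOn (fun z => InnerProductSpace.rankOne ℝ (x z) (x z)) s :=
  ((InnerProductSpace.rankOne ℝ).continuous.comp_continuousOn hx).clm_apply hx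

theorem continuousOn_mixScoreDeriv [Nonempty ι] (hm : ContinuousOn m s) (hV : ContinuousOn V s)
    (hx : ContinuousOn x s) (h : ∀ z ∈ s, 0 < V z) :
    ContinuousOn (fun z => mixScoreDeriv x₀ (m z) (V z) (x z)) s := by
  refine ContinuousOn.sub (ContinuousOn.sub ?_ ?_)
    (continuousOn_mixScore x₀ hm hV hx h).rankOne_self
  · exact ((continuousOn_mixSum x₀ hm hV hx h).inv₀ fun z hz => (mixSum_pos (h z hz) _).ne').smul
      (continuousOn_finsetSum _ fun _ _ =>
        (hV.gaussKernel (hx.sub (hm.smul continuousOn_const)) h).smul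
          (continuousOn_componentScore x₀ hm hV hx h _).rankOne_self)
  · exact (hV.inv₀ fun z hz => (h z hz).ne').smul continuousOn_const

end Continuity

theorem continuous_mixDensity (hV : 0 < V) : Continuous (mixDensity x₀ m V) := by
  rw [← continuousOn_univ]
  exact continuousOn_const.mul (continuousOn_mixSum x₀ (m := fun _ => m) (V := fun _ => V)
    (x := fun x => x) continuousOn_const continuousOn_const continuousOn_id fun _ _ => hV)

/-- The continuity equation along a trajectory of the probability flow: if the means and the
variance evolve by `m' = -f m` and `V' = -2 f V + g²`, and if the trajectory moves with the
velocity `-f x - (g² / 2) ∇ log ρ`, then the density `ρ` seen by it changes at the rate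
`-(div velocity) ρ`. -/
theorem hasDerivWithinAt_mixDensity_comp [Nonempty ι] {m V : ℝ → ℝ}
    {γ : ℝ → EuclideanSpace ℝ (Fin n)} {s : Set ℝ} {t a b : ℝ} (hVt : 0 < V t)
    (hm : HasDerivWithinAt m (-a * m t) s t)
    (hV : HasDerivWithinAt V (-2 * a * V t + b ^ 2) s t)
    (hγ : HasDerivWithinAt γ (-(a • γ t) - (b ^ 2 / 2) • mixScore x₀ (m t) (V t) (γ t)) s t) :
    HasDerivWithinAt (fun t => mixDensity x₀ (m t) (V t) (γ t))
      ((n * a + b ^ 2 / 2 * LinearMap.trace ℝ _ (mixScoreDeriv x₀ (m t) (V t) (γ t) :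
        EuclideanSpace ℝ (Fin n) →ₗ[ℝ] _)) * mixDensity x₀ (m t) (V t) (γ t)) s t := by
  set u : ι → EuclideanSpace ℝ (Fin n) := fun i => componentScore x₀ (m t) (V t) i (γ t) with hu
  set σ := mixScore x₀ (m t) (V t) (γ t) with hσ
  have hy : ∀ i, γ t - m t • x₀ i = -(V t • u i) := by
    intro i
    simp [hu, componentScore, smul_smul, hVt.ne']
  have hcomp : ∀ i, HasDerivWithinAt (fun t => gaussKernel (V t) (γ t - m t • x₀ i))
      (gaussKernel (V t) (γ t - m t • x₀ i) *
        (n * a - n * b ^ 2 / (2 * V t) + b ^ 2 / 2 * ‖u i‖ ^ 2 - b ^ 2 / 2 * ⟪u i, σ⟫)) s t := by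
    intro i
    have h1 : HasDerivWithinAt (fun t => γ t - m t • x₀ i)
        ((a * V t) • u i - (b ^ 2 / 2) • σ) s t := by
      refine (hγ.sub (hm.smul_const (x₀ i))).congr_deriv ?_
      have : m t • x₀ i = V t • u i + γ t := by
        rw [← sub_eq_iff_eq_add, ← neg_sub, hy, neg_neg]
      rw [mul_smul, this]
      simp only [neg_smul, smul_add, mul_smul]
      abel
    have h2 := h1.norm_sq
    have h3 : HasDerivWithinAt (fun t => (2 * Real.pi * V t) ^ (-(n : ℝ) / 2))
        ((2 * Real.pi * (-2 * a * V t + b ^ 2)) * (-(n : ℝ) / 2) *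
          (2 * Real.pi * V t) ^ (-(n : ℝ) / 2 - 1)) s t :=
      (hV.const_mul (2 * Real.pi)).rpow_const (Or.inl (by positivity))
    have h4 := (h2.fun_neg.fun_div (hV.const_mul 2) (by positivity)).exp
    refine (h3.fun_mul h4).congr_deriv ?_
    rw [Real.rpow_sub_one (by positivity)]
    simp only [hy, norm_neg, inner_neg_left, inner_sub_right, inner_smul_left, inner_smul_right,
      real_inner_self_eq_norm_sq, norm_smul, gaussKernel, Real.norm_eq_abs, mul_pow, sq_abs]
    have hpi := Real.pi_pos.ne'
    simp only [conj_trivial]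
    field_simp
    ring
  refine ((HasDerivWithinAt.fun_sum fun i _ => hcomp i).const_mul
    (Fintype.card ι : ℝ)⁻¹).congr_deriv ?_
  have hQ := (mixSum_pos (x₀ := x₀) (m := m t) hVt (γ t)).ne'
  have hcross : ∑ i, gaussKernel (V t) (γ t - m t • x₀ i) * ⟪u i, σ⟫ =
      mixSum x₀ (m t) (V t) (γ t) * ‖σ‖ ^ 2 := by
    rw [← real_inner_self_eq_norm_sq, ← real_inner_smul_left, hσ, mixSum_smul_mixScore hVt,
      sum_inner]
    simp only [real_inner_smul_left, hu]
  have hsum : ∑ i, gaussKernel (V t) (γ t - m t • x₀ i) *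
        (n * a - n * b ^ 2 / (2 * V t) + b ^ 2 / 2 * ‖u i‖ ^ 2 - b ^ 2 / 2 * ⟪u i, σ⟫) =
      mixSum x₀ (m t) (V t) (γ t) * (n * a - n * b ^ 2 / (2 * V t))
      + b ^ 2 / 2 * (∑ i, gaussKernel (V t) (γ t - m t • x₀ i) * ‖u i‖ ^ 2)
      - b ^ 2 / 2 * (mixSum x₀ (m t) (V t) (γ t) * ‖σ‖ ^ 2) := by
    rw [← hcross, mixSum, Finset.sum_mul, Finset.mul_sum, Finset.mul_sum, ← Finset.sum_add_distrib,
      ← Finset.sum_sub_distrib]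
    refine Finset.sum_congr rfl fun i _ => by ring
  rw [hsum, trace_mixScoreDeriv, mixDensity]
  simp only [← hσ]
  have hu' : ∀ i, componentScore x₀ (m t) (V t) i (γ t) = u i := fun _ => rfl
  simp only [hu']
  field_simp
  ring

end GaussianMixture

/-! ### Characteristic function of a Gaussian mixture -/

section MixtureLaw

open scoped RealInnerProductSpace

variable {n : ℕ}

theorem integral_gaussKernel_mul_cexp {V : ℝ} (hV : 0 < V) (ξ : EuclideanSpace ℝ (Fin n)) :
    ∫ y, (gaussKernel V y : ℂ) * Complex.exp (⟪y, ξ⟫ * Complex.I) =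
      Complex.exp (-(V * ‖ξ‖ ^ 2 / 2 : ℝ)) := by
  have hb : 0 < (((2 * V)⁻¹ : ℝ) : ℂ).re := by
    rw [Complex.ofReal_re]; positivity
  have h := GaussianFourier.integral_cexp_neg_mul_sq_norm_add hb Complex.I ξ
  have hcongr : ∀ y : EuclideanSpace ℝ (Fin n),
      (gaussKernel V y : ℂ) * Complex.exp (⟪y, ξ⟫ * Complex.I) =
      (((2 * Real.pi * V) ^ (-(n : ℝ) / 2) : ℝ) : ℂ) *
        Complex.exp (-((2 * V)⁻¹ : ℝ) * ‖y‖ ^ 2 + Complex.I * ⟪ξ, y⟫) := by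
    intro y
    rw [gaussKernel, Complex.ofReal_mul, Complex.ofReal_exp, mul_assoc, ← Complex.exp_add,
      real_inner_comm y ξ]
    congr 2
    push_cast
    ring
  simp_rw [hcongr]
  rw [integral_const_mul, h, finrank_euclideanSpace_fin]
  have h1 : (Real.pi : ℂ) / (((2 * V)⁻¹ : ℝ) : ℂ) = ((2 * Real.pi * V : ℝ) : ℂ) := by
    push_cast
    field_simp
  have h2 : ((n : ℂ) / 2) = (((n : ℝ) / 2 : ℝ) : ℂ) := by push_cast; ring
  rw [h1, h2, ← Complex.ofReal_cpow (by positivity), ← mul_assoc, ← Complex.ofReal_mul,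
    ← Real.rpow_add (by positivity)]
  have h3 : -(n : ℝ) / 2 + (n : ℝ) / 2 = 0 := by ring
  rw [h3, Real.rpow_zero, Complex.ofReal_one, one_mul, Complex.I_sq]
  congr 1
  push_cast
  field_simp
  ring

theorem integrable_gaussKernel {V : ℝ} (hV : 0 < V) :
    Integrable (gaussKernel V : EuclideanSpace ℝ (Fin n) → ℝ) := by
  have h := (GaussianFourier.integrable_cexp_neg_mul_sq_norm_add
    (b := (((2 * V)⁻¹ : ℝ) : ℂ)) (by rw [Complex.ofReal_re]; positivity) 0
    (0 : EuclideanSpace ℝ (Fin n))).re.const_mul ((2 * Real.pi * V) ^ (-(n : ℝ) / 2))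
  refine h.congr (ae_of_all _ fun y => ?_)
  simp only [gaussKernel, inner_zero_left, Complex.ofReal_zero, mul_zero, add_zero]
  congr 1
  have : -(((2 * V)⁻¹ : ℝ) : ℂ) * (‖y‖ : ℂ) ^ 2 = ((-‖y‖ ^ 2 / (2 * V) : ℝ) : ℂ) := by
    push_cast
    ring
  rw [this, ← Complex.ofReal_exp]
  exact Complex.ofReal_re _

variable {ι : Type*} [Fintype ι] {x₀ : ι → EuclideanSpace ℝ (Fin n)}

theorem charFun_uniformDiscrete (ξ : EuclideanSpace ℝ (Fin n)) :
    charFun (uniformDiscrete x₀) ξ =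
      (Fintype.card ι : ℂ)⁻¹ * ∑ i, Complex.exp (⟪x₀ i, ξ⟫ * Complex.I) := by
  rw [charFun_apply, uniformDiscrete, integral_smul_measure, integral_finsetSum_measure]
  · simp
  · intro i _
    exact integrable_dirac (by simp)

theorem integrable_mixDensity {m V : ℝ} (hV : 0 < V) : Integrable (mixDensity x₀ m V) :=
  (integrable_finsetSum _ fun _ _ => (integrable_gaussKernel hV).comp_sub_right _).const_mul _

theorem charFun_withDensity_mixDensity [Nonempty ι] {m V : ℝ} (hV : 0 < V)
    (ξ : EuclideanSpace ℝ (Fin n)) :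
    charFun (volume.withDensity fun x => ENNReal.ofReal (mixDensity x₀ m V x)) ξ =
      charFun (uniformDiscrete x₀) (m • ξ) * Complex.exp (-(V * ‖ξ‖ ^ 2 / 2 : ℝ)) := by
  rw [charFun_apply, integral_withDensity_eq_integral_toReal_smul
    (continuous_mixDensity hV).measurable.ennreal_ofReal (by simp)]
  have h1 : ∀ x, (ENNReal.ofReal (mixDensity x₀ m V x)).toReal • Complex.exp (⟪x, ξ⟫ * Complex.I) =
      (Fintype.card ι : ℂ)⁻¹ * ∑ i, (gaussKernel V (x - m • x₀ i) : ℂ) *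
        Complex.exp (⟪x, ξ⟫ * Complex.I) := by
    intro x
    rw [ENNReal.toReal_ofReal (mixDensity_pos hV x).le, mixDensity, mixSum, Complex.real_smul]
    push_cast
    rw [mul_assoc, Finset.sum_mul]
  simp_rw [h1]
  rw [integral_const_mul, integral_finsetSum, charFun_uniformDiscrete, mul_assoc, Finset.sum_mul]
  · congr 1
    refine Finset.sum_congr rfl fun i _ => ?_
    rw [← integral_gaussKernel_mul_cexp hV ξ, ← integral_const_mul,
      ← integral_add_right_eq_self _ (m • x₀ i)]
    refine integral_congr_ae (ae_of_all _ fun y => ?_)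
    simp only [add_sub_cancel_right, inner_add_left, inner_smul_left, inner_smul_right,
      Complex.ofReal_add, add_mul, Complex.exp_add]
    simp
    ring
  · intro i _
    have hg : Integrable (fun x => gaussKernel V (x - m • x₀ i)) :=
      (integrable_gaussKernel hV).comp_sub_right _
    refine hg.ofReal.mul_bdd (c := 1) (by fun_prop) (ae_of_all _ fun x => ?_)
    rw [Complex.norm_exp_ofReal_mul_I]

/-- A law whose characteristic function is that of `m • x₀ + √V • (standard Gaussian)` has the
mixture density as its continuous density. -/
theorem isContinuousDensity_mixDensity [Nonempty ι] {m V : ℝ} (hV : 0 < V)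
    {ν : Measure (EuclideanSpace ℝ (Fin n))} [IsFiniteMeasure ν]
    (hν : ∀ ξ, charFun ν ξ =
      charFun (uniformDiscrete x₀) (m • ξ) * Complex.exp (-(V * ‖ξ‖ ^ 2 / 2 : ℝ))) :
    IsContinuousDensity ν (mixDensity x₀ m V) := by
  refine ⟨continuous_mixDensity hV, fun x => (mixDensity_pos hV x).le, ?_⟩
  have : IsFiniteMeasure (volume.withDensity fun x => ENNReal.ofReal (mixDensity x₀ m V x)) :=
    isFiniteMeasure_withDensity_ofReal (integrable_mixDensity hV).2
  exact Measure.ext_of_charFun (funext fun ξ => by rw [hν, charFun_withDensity_mixDensity hV])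

end MixtureLaw

/-! ### Wiener integrals of step functions -/

section WienerStep

open scoped RealInnerProductSpace

variable {n : ℕ} {Ω : Type*} [MeasurableSpace Ω] {P : Measure Ω}

/-- The step function `∑ c t • 1_{(0, t]}` encoded by the finitely supported function `c`. -/
noncomputable def stepFun (s : ℝ) : (ℝ≥0 →₀ ℝ) →ₗ[ℝ] ℝ :=
  Finsupp.linearCombination ℝ fun t : ℝ≥0 => (Ioc (0 : ℝ) t).indicator (fun _ => (1 : ℝ)) s

/-- The Wiener integral `∑ c t • W t` of the step function encoded by `c`. -/
noncomputable def wienerSum {F : Type*} [AddCommGroup F] [Module ℝ F] (W : ℝ≥0 → Ω → F) (ω : Ω) :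
    (ℝ≥0 →₀ ℝ) →ₗ[ℝ] F :=
  Finsupp.linearCombination ℝ fun t => W t ω

theorem stepFun_single (t : ℝ≥0) (a s : ℝ) :
    stepFun s (Finsupp.single t a) = a * (Ioc (0 : ℝ) t).indicator (fun _ => (1 : ℝ)) s := by
  simp [stepFun]

theorem wienerSum_single {Ω F : Type*} [AddCommGroup F] [Module ℝ F] (W : ℝ≥0 → Ω → F) (ω : Ω)
    (t : ℝ≥0) (a : ℝ) : wienerSum W ω (Finsupp.single t a) = a • W t ω := by
  simp [wienerSum]

theorem measurable_linearCombination_path {F : Type*} [AddCommGroup F] [Module ℝ F]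
    [MeasurableSpace F] [MeasurableAdd₂ F] [MeasurableConstSMul ℝ F] (c : ℝ≥0 →₀ ℝ) :
    Measurable fun path : ℝ≥0 → F => Finsupp.linearCombination ℝ path c := by
  simp only [Finsupp.linearCombination_apply, Finsupp.sum]
  fun_prop

theorem integral_indicator_Ioc_mul (s t : ℝ≥0) :
    ∫ r, (Ioc (0 : ℝ) s).indicator (fun _ => (1 : ℝ)) r *
      (Ioc (0 : ℝ) t).indicator (fun _ => (1 : ℝ)) r = min s t := by
  have : ∀ r, (Ioc (0 : ℝ) s).indicator (fun _ => (1 : ℝ)) r *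
      (Ioc (0 : ℝ) t).indicator (fun _ => (1 : ℝ)) r =
      (Ioc (0 : ℝ) (min s t : ℝ≥0)).indicator (fun _ => (1 : ℝ)) r := by
    intro r
    rw [← inter_indicator_mul, Ioc_inter_Ioc]
    simp
  simp_rw [this]
  rw [integral_indicator_const _ measurableSet_Ioc]
  simp

theorem integrable_indicator_Ioc_mul (s t : ℝ≥0) :
    Integrable fun r => (Ioc (0 : ℝ) s).indicator (fun _ => (1 : ℝ)) r *
      (Ioc (0 : ℝ) t).indicator (fun _ => (1 : ℝ)) r := by
  simp_rw [← inter_indicator_mul]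
  rw [integrable_indicator_iff (measurableSet_Ioc.inter measurableSet_Ioc)]
  refine integrableOn_const ?_
  rw [Ioc_inter_Ioc]
  simp

theorem integral_stepFun_sq (c : ℝ≥0 →₀ ℝ) :
    ∫ r, stepFun r c ^ 2 = ∑ s ∈ c.support, ∑ t ∈ c.support, c s * c t * min (s : ℝ) t := by
  have : ∀ r, stepFun r c ^ 2 = ∑ s ∈ c.support, ∑ t ∈ c.support, c s * c t *
      ((Ioc (0 : ℝ) s).indicator (fun _ => (1 : ℝ)) r *
      (Ioc (0 : ℝ) t).indicator (fun _ => (1 : ℝ)) r) := by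
    intro r
    rw [stepFun, Finsupp.linearCombination_apply, Finsupp.sum, sq, Finset.sum_mul_sum]
    refine Finset.sum_congr rfl fun _ _ => Finset.sum_congr rfl fun _ _ => ?_
    simp only [smul_eq_mul]
    ring
  simp_rw [this]
  rw [integral_finsetSum _ fun _ _ => integrable_finsetSum _ fun _ _ =>
    (integrable_indicator_Ioc_mul _ _).const_mul _]
  refine Finset.sum_congr rfl fun s _ => ?_
  rw [integral_finsetSum _ fun _ _ => (integrable_indicator_Ioc_mul _ _).const_mul _]
  refine Finset.sum_congr rfl fun t _ => ?_
  rw [integral_const_mul, integral_indicator_Ioc_mul, NNReal.coe_min]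

theorem charFun_wienerSum_real {B : ℝ≥0 → Ω → ℝ} (hB : IsPreBrownianReal B P)
    (c : ℝ≥0 →₀ ℝ) :
    charFun (P.map fun ω => wienerSum B ω c) 1 =
      Complex.exp (-((∫ r, stepFun r c ^ 2) / 2 : ℝ)) := by
  have hP := hB.isGaussianProcess.isProbabilityMeasure
  have hg : HasGaussianLaw (fun ω => ∑ t ∈ c.support, c t • B t ω) P :=
    (hB.isGaussianProcess.smul c).hasGaussianLaw_fun_sum
  have hL2 : ∀ t, MemLp (B t) 2 P := fun t =>
    (hB.isGaussianProcess.hasGaussianLaw_eval t).memLp (by simp)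
  have hvar : Var[fun ω => ∑ t ∈ c.support, c t • B t ω; P] = ∫ r, stepFun r c ^ 2 := by
    rw [← covariance_self hg.aemeasurable, integral_stepFun_sq,
      covariance_fun_sum_fun_sum' (X := fun t ω => c t • B t ω) (Y := fun t ω => c t • B t ω)
        (fun t _ => (hL2 t).const_smul (c t)) (fun t _ => (hL2 t).const_smul (c t))]
    refine Finset.sum_congr rfl fun s _ => Finset.sum_congr rfl fun t _ => ?_
    simp only [smul_eq_mul]
    rw [covariance_const_mul_left, covariance_const_mul_right, hB.covariance_fun_eval]
    push_cast
    ring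
  have hmean : ∫ ω, ∑ t ∈ c.support, c t • B t ω ∂P = 0 := by
    rw [integral_finsetSum (f := fun t ω => c t • B t ω) _
      fun t _ => (hB.integrable_eval t).smul (c t)]
    refine Finset.sum_eq_zero fun t _ => ?_
    rw [integral_smul, hB.integral_eval, smul_zero]
  have hsum : (fun ω => wienerSum B ω c) = fun ω => ∑ t ∈ c.support, c t • B t ω := by
    ext ω
    rw [wienerSum, Finsupp.linearCombination_apply, Finsupp.sum]
  rw [hsum, hg.charFun_map_eq]
  simp only [RCLike.inner_apply, conj_trivial, mul_one, hmean, hvar]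
  congr 1
  push_cast
  ring

variable {W : ℝ≥0 → Ω → EuclideanSpace ℝ (Fin n)}

theorem measurable_wienerSum (hW : ∀ t, Measurable (W t)) (c : ℝ≥0 →₀ ℝ) :
    Measurable fun ω => wienerSum W ω c := by
  exact (measurable_linearCombination_path c).comp (measurable_pi_lambda _ hW)

theorem charFun_wienerSum (hW : IsStandardWiener W P) (c : ℝ≥0 →₀ ℝ)
    (ξ : EuclideanSpace ℝ (Fin n)) :
    charFun (P.map fun ω => wienerSum W ω c) ξ =
      Complex.exp (-((∫ r, stepFun r c ^ 2) * ‖ξ‖ ^ 2 / 2 : ℝ)) := by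
  -- the coordinates of `W` are independent, so the characteristic function factorizes
  set Y : Fin n → Ω → ℝ := fun i ω => wienerSum (fun t ω => W t ω i) ω (ξ i • c) with hY
  have hcoord : ∀ i t, Measurable fun ω => W t ω i := fun i t =>
    (measurable_pi_apply i).comp ((PiLp.continuous_ofLp 2 _).measurable.comp (hW.measurable t))
  have hYm : ∀ i, AEMeasurable (Y i) P := by
    intro i
    exact ((measurable_linearCombination_path _).comp
      (measurable_pi_lambda _ fun t => hcoord i t)).aemeasurable
  have hind : iIndepFun Y P := by
    exact hW.indep.comp (fun i path => Finsupp.linearCombination ℝ path (ξ i • c))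
      fun i => measurable_linearCombination_path _
  have hinner : ∀ ω, ⟪wienerSum W ω c, ξ⟫ = ∑ i, Y i ω := by
    intro ω
    rw [PiLp.inner_apply]
    refine Finset.sum_congr rfl fun i _ => ?_
    simp only [hY, wienerSum, Finsupp.linearCombination_apply, Finsupp.sum, map_smul,
      RCLike.inner_apply, conj_trivial]
    rw [smul_eq_mul]
    congr 1
    simp
  have h1 : charFun (P.map fun ω => wienerSum W ω c) ξ = charFun (P.map fun ω => ∑ i, Y i ω) 1 := by
    rw [charFun_apply, charFun_apply, integral_map (measurable_wienerSum hW.measurable c).aemeasurable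
      (by fun_prop), integral_map (Finset.aemeasurable_fun_sum _ fun i _ => hYm i) (by fun_prop)]
    simp [hinner]
  rw [h1, hind.charFun_map_fun_sum_eq_prod hYm, Finset.prod_apply]
  have h2 : ∀ i, charFun (P.map (Y i)) 1 =
      Complex.exp (-((∫ r, stepFun r c ^ 2) * ξ i ^ 2 / 2 : ℝ)) := by
    intro i
    rw [charFun_wienerSum_real (hW.brownian i).toIsPreBrownianReal]
    simp only [map_smul, smul_eq_mul, mul_pow, integral_const_mul]
    rw [mul_comm]
  simp_rw [h2]
  rw [← Complex.exp_sum]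
  congr 1
  rw [EuclideanSpace.real_norm_sq_eq]
  push_cast
  simp only [Finset.mul_sum, Finset.sum_div, Finset.sum_neg_distrib]

variable [IsProbabilityMeasure P]

theorem charFun_add_wienerSum (hW : IsStandardWiener W P)
    {Y : Ω → EuclideanSpace ℝ (Fin n)} (hY : Measurable Y)
    (hind : IndepFun Y (fun (ω : Ω) (t : ℝ≥0) => W t ω) P) (c : ℝ≥0 →₀ ℝ)
    (ξ : EuclideanSpace ℝ (Fin n)) :
    charFun (P.map fun ω => Y ω + wienerSum W ω c) ξ = charFun (P.map Y) ξ *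
      Complex.exp (-((∫ r, stepFun r c ^ 2) * ‖ξ‖ ^ 2 / 2 : ℝ)) := by
  have h : IndepFun Y (fun ω => wienerSum W ω c) P := by
    exact hind.comp (φ := id) (ψ := fun path => Finsupp.linearCombination ℝ path c)
      measurable_id (measurable_linearCombination_path c)
  rw [h.charFun_map_fun_add_eq_mul hY.aemeasurable
    (measurable_wienerSum hW.measurable c).aemeasurable, Pi.mul_apply, charFun_wienerSum hW]

theorem tendsto_charFun_of_tendsto_ae {Y : ℕ → Ω → EuclideanSpace ℝ (Fin n)}
    {Z : Ω → EuclideanSpace ℝ (Fin n)} (hY : ∀ m, AEMeasurable (Y m) P)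
    (h : ∀ᵐ ω ∂P, Tendsto (fun m => Y m ω) atTop (𝓝 (Z ω))) (ξ : EuclideanSpace ℝ (Fin n)) :
    Tendsto (fun m => charFun (P.map (Y m)) ξ) atTop (𝓝 (charFun (P.map Z) ξ)) := by
  have hZ : AEMeasurable Z P := aemeasurable_of_tendsto_metrizable_ae' hY h
  have key : ∀ Y : Ω → EuclideanSpace ℝ (Fin n), AEMeasurable Y P →
      charFun (P.map Y) ξ = ∫ ω, Complex.exp (⟪Y ω, ξ⟫ * Complex.I) ∂P := fun Y hY => by
    rw [charFun_apply, integral_map hY (by fun_prop)]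
  simp_rw [key _ (hY _), key _ hZ]
  refine tendsto_integral_of_dominated_convergence (fun _ => 1) (fun m => ?_)
    (integrable_const _) (fun m => ae_of_all _ fun ω => ?_) ?_
  · exact Continuous.comp_aestronglyMeasurable (g := fun y => Complex.exp (⟪y, ξ⟫ * Complex.I))
      (by fun_prop) (hY m).aestronglyMeasurable
  · rw [Complex.norm_exp_ofReal_mul_I]
  · filter_upwards [h] with ω hω
    have hc : Continuous fun y : EuclideanSpace ℝ (Fin n) => Complex.exp (⟪y, ξ⟫ * Complex.I) := by
      fun_prop
    exact (hc.tendsto _).comp hω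

end WienerStep

/-! ### Left-endpoint step functions on a uniform grid -/

section Grid

/-- The step function on `(0, t]` which takes the value `u (k t / m)` on `(k t / m, (k + 1) t / m]`,
for `k < m`, written as a combination of indicators of intervals `(0, r]`. -/
noncomputable def gridStep (u : ℝ → ℝ) (t : ℝ) (m : ℕ) (s : ℝ) : ℝ :=
  ∑ k ∈ Finset.range m, u ((k : ℝ) * t / m) *
    ((Ioc 0 (((k : ℝ) + 1) * t / m)).indicator (fun _ => (1 : ℝ)) s -
      (Ioc 0 ((k : ℝ) * t / m)).indicator (fun _ => (1 : ℝ)) s)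

theorem grid_mem_Icc {t : ℝ} (ht : 0 ≤ t) {k m : ℕ} (hk : k ≤ m) :
    (k : ℝ) * t / m ∈ Icc 0 t := by
  refine ⟨by positivity, ?_⟩
  rcases Nat.eq_zero_or_pos m with rfl | hm
  · simpa using ht
  · rw [div_le_iff₀ (by positivity), mul_comm]
    gcongr

theorem grid_succ_mem_Icc {t : ℝ} (ht : 0 ≤ t) {k m : ℕ} (hk : k < m) :
    ((k : ℝ) + 1) * t / m ∈ Icc 0 t := by
  have := grid_mem_Icc ht (Nat.succ_le_of_lt hk)
  push_cast at this
  exact this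

theorem gridStep_of_notMem {u : ℝ → ℝ} {t : ℝ} (ht : 0 ≤ t) (m : ℕ) {s : ℝ} (hs : s ∉ Ioc 0 t) :
    gridStep u t m s = 0 := by
  refine Finset.sum_eq_zero fun k hk => ?_
  rw [Finset.mem_range] at hk
  rw [indicator_of_notMem fun h => hs ⟨h.1, h.2.trans (grid_succ_mem_Icc ht hk).2⟩,
    indicator_of_notMem fun h => hs ⟨h.1, h.2.trans (grid_mem_Icc ht hk.le).2⟩]
  simp

theorem exists_gridStep_eq (u : ℝ → ℝ) {t s : ℝ} (hs : s ∈ Ioc 0 t) {m : ℕ} (hm : 0 < m) :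
    ∃ r ∈ Icc 0 t, |r - s| ≤ t / m ∧ gridStep u t m s = u r := by
  have ht : 0 < t := hs.1.trans_le hs.2
  have hm' : (0 : ℝ) < m := by exact_mod_cast hm
  have hx : 0 < s * m / t := div_pos (mul_pos hs.1 hm') ht
  obtain ⟨k, hk⟩ : ∃ k, ⌈s * m / t⌉₊ = k + 1 :=
    Nat.exists_eq_succ_of_ne_zero (Nat.ceil_pos.2 hx).ne'
  have hk1 : (k : ℝ) < s * m / t := Nat.lt_ceil.1 (by omega)
  have hk2 : s * m / t ≤ k + 1 := by
    have := Nat.le_ceil (s * m / t)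
    rw [hk] at this
    exact_mod_cast this
  have hlow : (k : ℝ) * t / m < s := by
    rw [lt_div_iff₀ ht] at hk1
    rwa [div_lt_iff₀ hm']
  have hupp : s ≤ ((k : ℝ) + 1) * t / m := by
    rw [div_le_iff₀ ht] at hk2
    rwa [le_div_iff₀ hm']
  have hkm : k < m := by
    have : (k : ℝ) < m := hk1.trans_le (by rw [div_le_iff₀ ht, mul_comm]; gcongr; exact hs.2)
    exact_mod_cast this
  refine ⟨(k : ℝ) * t / m, grid_mem_Icc ht.le hkm.le, ?_, ?_⟩
  · rw [abs_le]
    have : ((k : ℝ) + 1) * t / m = (k : ℝ) * t / m + t / m := by ring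
    constructor <;> linarith [div_pos ht hm']
  · rw [gridStep, Finset.sum_eq_single k]
    · rw [indicator_of_mem (mem_Ioc.2 ⟨hs.1, hupp⟩), indicator_of_notMem fun h => hlow.not_ge h.2]
      simp
    · intro j _ hjk
      rcases lt_or_gt_of_ne hjk with h | h
      · have h1 : ((j : ℝ) + 1) ≤ k := by exact_mod_cast h
        have h2 : ((j : ℝ) + 1) * t / m < s := lt_of_le_of_lt (by gcongr) hlow
        have h3 : (j : ℝ) * t / m < s := lt_of_le_of_lt (by gcongr; linarith) h2
        rw [indicator_of_notMem fun h => h2.not_ge h.2, indicator_of_notMem fun h => h3.not_ge h.2]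
        simp
      · have h1 : (k : ℝ) + 1 ≤ j := by exact_mod_cast h
        have h2 : s ≤ (j : ℝ) * t / m := hupp.trans (by gcongr)
        have h3 : s ≤ ((j : ℝ) + 1) * t / m := h2.trans (by gcongr; linarith)
        rw [indicator_of_mem (mem_Ioc.2 ⟨hs.1, h2⟩), indicator_of_mem (mem_Ioc.2 ⟨hs.1, h3⟩)]
        simp
    · intro h
      exact absurd (Finset.mem_range.2 hkm) h

theorem abs_gridStep_le {u : ℝ → ℝ} {t C : ℝ} (ht : 0 ≤ t) (hC : ∀ r ∈ Icc 0 t, |u r| ≤ C)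
    (m : ℕ) (s : ℝ) : |gridStep u t m s| ≤ (Ioc 0 t).indicator (fun _ => C) s := by
  by_cases hs : s ∈ Ioc 0 t
  · rw [indicator_of_mem hs]
    rcases Nat.eq_zero_or_pos m with rfl | hm
    · simpa [gridStep] using (abs_nonneg _).trans (hC 0 ⟨le_rfl, ht⟩)
    · obtain ⟨r, hr, -, h⟩ := exists_gridStep_eq u hs hm
      rw [h]
      exact hC r hr
  · rw [gridStep_of_notMem ht m hs, indicator_of_notMem hs, abs_zero]

theorem tendsto_gridStep {u : ℝ → ℝ} (hu : Continuous u) {t : ℝ} (ht : 0 ≤ t) (s : ℝ) :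
    Tendsto (fun m => gridStep u t m s) atTop (𝓝 ((Ioc 0 t).indicator u s)) := by
  by_cases hs : s ∈ Ioc 0 t
  · rw [indicator_of_mem hs]
    have h : ∀ m : ℕ, ∃ r, |r - s| ≤ t / m ∧ (0 < m → gridStep u t m s = u r) := by
      intro m
      rcases Nat.eq_zero_or_pos m with rfl | hm
      · exact ⟨s, by simp, fun h => absurd h (lt_irrefl _)⟩
      · obtain ⟨r, -, h1, h2⟩ := exists_gridStep_eq u hs hm
        exact ⟨r, h1, fun _ => h2⟩
    choose r hr1 hr2 using h
    have hr : Tendsto r atTop (𝓝 s) := by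
      rw [tendsto_iff_dist_tendsto_zero]
      exact squeeze_zero (fun _ => dist_nonneg) hr1 (tendsto_const_div_atTop_nhds_zero_nat t)
    refine ((hu.tendsto s).comp hr).congr' ?_
    filter_upwards [eventually_gt_atTop 0] with m hm using (hr2 m hm).symm
  · simp_rw [gridStep_of_notMem ht _ hs, indicator_of_notMem hs]
    exact tendsto_const_nhds

theorem measurable_gridStep (u : ℝ → ℝ) (t : ℝ) (m : ℕ) : Measurable (gridStep u t m) := by
  unfold gridStep
  refine Finset.measurable_fun_sum _ fun k _ => ?_
  exact ((measurable_const.indicator measurableSet_Ioc).sub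
    (measurable_const.indicator measurableSet_Ioc)).const_mul _

end Grid

/-! ### Sums of increments of stochastic integrals -/

section IncrementSums

open scoped RealInnerProductSpace

variable {n : ℕ} {Ω : Type*} {W : ℝ≥0 → Ω → EuclideanSpace ℝ (Fin n)}

/-- The step function whose Wiener integral is the left-endpoint sum `stochRiemannSum`. -/
noncomputable def riemannCoeff (g : ℝ → ℝ) (t : ℝ) (m : ℕ) : ℝ≥0 →₀ ℝ :=
  ∑ k ∈ Finset.range m, g ((k : ℝ) * t / m) •
    (Finsupp.single (Real.toNNReal (((k : ℝ) + 1) * t / m)) 1 -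
      Finsupp.single (Real.toNNReal ((k : ℝ) * t / m)) 1)

theorem wienerSum_riemannCoeff (g : ℝ → ℝ) (t : ℝ) (m : ℕ) (ω : Ω) :
    wienerSum W ω (riemannCoeff g t m) = stochRiemannSum g W t m ω := by
  simp [riemannCoeff, stochRiemannSum, wienerSum_single]

theorem stepFun_riemannCoeff (g : ℝ → ℝ) {t : ℝ} (ht : 0 ≤ t) (m : ℕ) (s : ℝ) :
    stepFun s (riemannCoeff g t m) = gridStep g t m s := by
  simp only [riemannCoeff, gridStep, map_sum, map_smul, map_sub, stepFun_single, one_mul,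
    smul_eq_mul]
  refine Finset.sum_congr rfl fun k _ => ?_
  rw [Real.coe_toNNReal _ (by positivity), Real.coe_toNNReal _ (by positivity)]

variable [MeasurableSpace Ω] {P : Measure Ω}

theorem exists_common_seq_tendsto_ae {F : Type*} [PseudoEMetricSpace F] {Y : ℕ → ℕ → Ω → F}
    {Z : ℕ → Ω → F} (N : ℕ) (h : ∀ k < N, TendstoInMeasure P (Y k) atTop (Z k)) :
    ∃ ns : ℕ → ℕ, StrictMono ns ∧ ∀ k < N, ∀ᵐ ω ∂P,
      Tendsto (fun m => Y k (ns m) ω) atTop (𝓝 (Z k ω)) := by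
  induction N with
  | zero => exact ⟨id, strictMono_id, by simp⟩
  | succ N ih =>
    obtain ⟨ns, hns, hlim⟩ := ih fun k hk => h k (hk.trans (Nat.lt_succ_self N))
    obtain ⟨ms, hms, hlim'⟩ :=
      ((h N (Nat.lt_succ_self N)).comp hns.tendsto_atTop).exists_seq_tendsto_ae
    refine ⟨ns ∘ ms, hns.comp hms, fun k hk => ?_⟩
    rcases Nat.lt_succ_iff_lt_or_eq.1 hk with hk | rfl
    · filter_upwards [hlim k hk] with ω hω using hω.comp hms.tendsto_atTop
    · exact hlim'

variable [IsProbabilityMeasure P]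

/-- Sums of increments of stochastic integrals `Z s = ∫₀ˢ g dW` over a grid have the law of the
Wiener integral of the product of `g` with a step function. -/
theorem charFun_add_sum_increments (hW : IsStandardWiener W P)
    {Y : Ω → EuclideanSpace ℝ (Fin n)} (hY : Measurable Y)
    (hind : IndepFun Y (fun (ω : Ω) (t : ℝ≥0) => W t ω) P)
    {g : ℝ → ℝ} (hg : Continuous g) {t : ℝ} (ht : 0 ≤ t) {Z : ℝ → Ω → EuclideanSpace ℝ (Fin n)}
    (hZ : ∀ s ∈ Icc 0 t, IsItoIntegral P g W s (Z s)) (β : ℝ → ℝ) (N : ℕ) :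
    AEMeasurable (fun ω => Y ω + ∑ k ∈ Finset.range N, β ((k : ℝ) * t / N) •
      (Z (((k : ℝ) + 1) * t / N) ω - Z ((k : ℝ) * t / N) ω)) P ∧
    ∀ ξ, charFun (P.map fun ω => Y ω + ∑ k ∈ Finset.range N, β ((k : ℝ) * t / N) •
      (Z (((k : ℝ) + 1) * t / N) ω - Z ((k : ℝ) * t / N) ω)) ξ = charFun (P.map Y) ξ *
      Complex.exp (-((∫ s, (g s * gridStep β t N s) ^ 2) * ‖ξ‖ ^ 2 / 2 : ℝ)) := by
  obtain ⟨ns, hns, hlim⟩ := exists_common_seq_tendsto_ae (P := P)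
    (Y := fun k m ω => stochRiemannSum g W ((k : ℝ) * t / N) m ω)
    (Z := fun k => Z ((k : ℝ) * t / N)) (N + 1)
    fun k hk => hZ _ (grid_mem_Icc ht (Nat.lt_succ_iff.1 hk))
  set c : ℕ → ℝ≥0 →₀ ℝ := fun m => ∑ k ∈ Finset.range N, β ((k : ℝ) * t / N) •
    (riemannCoeff g (((k : ℝ) + 1) * t / N) (ns m) - riemannCoeff g ((k : ℝ) * t / N) (ns m)) with hc
  have hlim' : ∀ᵐ ω ∂P, Tendsto (fun m => Y ω + wienerSum W ω (c m)) atTop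
      (𝓝 (Y ω + ∑ k ∈ Finset.range N, β ((k : ℝ) * t / N) •
        (Z (((k : ℝ) + 1) * t / N) ω - Z ((k : ℝ) * t / N) ω))) := by
    have hall : ∀ᵐ ω ∂P, ∀ k < N + 1, Tendsto (fun m => stochRiemannSum g W ((k : ℝ) * t / N)
        (ns m) ω) atTop (𝓝 (Z ((k : ℝ) * t / N) ω)) :=
      ae_all_iff.2 fun k => by
        by_cases hk : k < N + 1
        · filter_upwards [hlim k hk] with ω hω _ using hω
        · exact ae_of_all _ fun ω h => absurd h hk
    filter_upwards [hall] with ω hω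
    refine tendsto_const_nhds.add ?_
    simp only [hc, map_sum, map_smul, map_sub, wienerSum_riemannCoeff]
    refine tendsto_finsetSum _ fun k hk => Tendsto.const_smul (Tendsto.sub ?_ ?_) _
    · have := hω (k + 1) (by have := Finset.mem_range.1 hk; omega)
      push_cast at this
      exact this
    · exact hω k (by have := Finset.mem_range.1 hk; omega)
  have hmeas : ∀ m, AEMeasurable (fun ω => Y ω + wienerSum W ω (c m)) P := fun m =>
    (hY.add (measurable_wienerSum hW.measurable _)).aemeasurable
  refine ⟨aemeasurable_of_tendsto_metrizable_ae' hmeas hlim', fun ξ => ?_⟩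
  have h1 := tendsto_charFun_of_tendsto_ae hmeas hlim' ξ
  simp_rw [charFun_add_wienerSum hW hY hind] at h1
  refine tendsto_nhds_unique h1 (Tendsto.const_mul _ ?_)
  have h2 : Tendsto (fun m => ∫ s, stepFun s (c m) ^ 2) atTop
      (𝓝 (∫ s, (g s * gridStep β t N s) ^ 2)) := by
    obtain ⟨C, hC⟩ := isCompact_Icc.exists_bound_of_continuousOn (s := Icc 0 t) hg.continuousOn
    have hstep : ∀ m s, stepFun s (c m) = ∑ k ∈ Finset.range N, β ((k : ℝ) * t / N) *
        (gridStep g (((k : ℝ) + 1) * t / N) (ns m) s - gridStep g ((k : ℝ) * t / N) (ns m) s) := by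
      intro m s
      simp only [hc, map_sum, map_smul, map_sub, smul_eq_mul]
      refine Finset.sum_congr rfl fun k _ => ?_
      rw [stepFun_riemannCoeff g (by positivity), stepFun_riemannCoeff g (by positivity)]
    simp_rw [hstep]
    set D := ∑ k ∈ Finset.range N, |β ((k : ℝ) * t / N)| * (C + C) with hD
    refine tendsto_integral_of_dominated_convergence ((Ioc 0 t).indicator fun _ => D ^ 2)
      (fun m => ?_) ?_ (fun m => ae_of_all _ fun s => ?_) (ae_of_all _ fun s => ?_)
    · refine Measurable.aestronglyMeasurable (Measurable.pow_const ?_ 2)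
      exact Finset.measurable_fun_sum _ fun k _ =>
        ((measurable_gridStep _ _ _).sub (measurable_gridStep _ _ _)).const_mul _
    · rw [integrable_indicator_iff measurableSet_Ioc]
      exact integrableOn_const (by simp)
    · by_cases hs : s ∈ Ioc 0 t
      · rw [indicator_of_mem hs, norm_pow]
        refine pow_le_pow_left₀ (norm_nonneg _) ?_ 2
        have hb : ∀ r ∈ Icc 0 t, |gridStep g r (ns m) s| ≤ C := fun r hr =>
          (abs_gridStep_le hr.1 (fun q hq => hC q ⟨hq.1, hq.2.trans hr.2⟩) _ _).trans
            (indicator_apply_le' (fun _ => le_rfl) fun _ => (norm_nonneg _).trans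
              (hC 0 ⟨le_rfl, ht⟩))
        refine norm_sum_le_of_le _ fun k hk => ?_
        rw [Finset.mem_range] at hk
        rw [norm_mul, Real.norm_eq_abs]
        refine mul_le_mul_of_nonneg_left ((abs_sub _ _).trans (add_le_add ?_ ?_)) (abs_nonneg _)
        · exact hb _ (grid_succ_mem_Icc ht hk)
        · exact hb _ (grid_mem_Icc ht hk.le)
      · rw [indicator_of_notMem hs, Finset.sum_eq_zero]
        · simp
        · intro k hk
          rw [Finset.mem_range] at hk
          rw [gridStep_of_notMem (by positivity), gridStep_of_notMem (by positivity)]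
          · simp
          · exact fun h => hs ⟨h.1, h.2.trans (grid_mem_Icc ht hk.le).2⟩
          · exact fun h => hs ⟨h.1, h.2.trans (grid_succ_mem_Icc ht hk).2⟩
    · have hind' : ∀ r, (Ioc 0 r).indicator g s =
          g s * (Ioc 0 r).indicator (fun _ => (1 : ℝ)) s := by
        intro r
        by_cases hr : s ∈ Ioc 0 r <;> simp [hr]
      have heq : g s * gridStep β t N s = ∑ k ∈ Finset.range N, β ((k : ℝ) * t / N) *
          ((Ioc 0 (((k : ℝ) + 1) * t / N)).indicator g s -
            (Ioc 0 ((k : ℝ) * t / N)).indicator g s) := by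
        rw [gridStep, Finset.mul_sum]
        refine Finset.sum_congr rfl fun k _ => ?_
        rw [hind', hind']
        ring
      rw [heq]
      refine (tendsto_finsetSum _ fun k _ => Tendsto.const_mul _ (Tendsto.sub ?_ ?_)).pow 2
      · exact (tendsto_gridStep hg (by positivity) s).comp hns.tendsto_atTop
      · exact (tendsto_gridStep hg (by positivity) s).comp hns.tendsto_atTop
  have hcont : Continuous fun v : ℝ => Complex.exp (-(v * ‖ξ‖ ^ 2 / 2 : ℝ)) := by fun_prop
  exact (hcont.tendsto _).comp h2

end IncrementSums

/-! ### The law of the forward diffusion -/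

section LinearSDE

/-- The factor `exp (-∫₀ᵗ f)` by which the drift `-f x` contracts the mean up to time `t`. -/
noncomputable def meanScale (f : ℝ → ℝ) (t : ℝ) : ℝ := Real.exp (-∫ s in (0 : ℝ)..t, f s)

/-- The variance at time `t` of each coordinate of the noise accumulated by
`dx = -f x dt + g dW`. -/
noncomputable def noiseVar (f g : ℝ → ℝ) (t : ℝ) : ℝ :=
  meanScale f t ^ 2 * ∫ s in (0 : ℝ)..t, (g s * (meanScale f s)⁻¹) ^ 2

variable {f g : ℝ → ℝ}

theorem meanScale_pos (f : ℝ → ℝ) (t : ℝ) : 0 < meanScale f t := Real.exp_pos _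

theorem hasDerivAt_meanScale (hf : Continuous f) (t : ℝ) :
    HasDerivAt (meanScale f) (-f t * meanScale f t) t := by
  refine ((hf.integral_hasStrictDerivAt 0 t).hasDerivAt.neg.exp).congr_deriv ?_
  rw [meanScale, mul_comm]
  rfl

theorem continuous_meanScale (hf : Continuous f) : Continuous (meanScale f) :=
  continuous_iff_continuousAt.2 fun t => (hasDerivAt_meanScale hf t).continuousAt

theorem continuous_noise_integrand (hf : Continuous f) (hg : Continuous g) :
    Continuous fun s => (g s * (meanScale f s)⁻¹) ^ 2 :=
  (hg.mul ((continuous_meanScale hf).inv₀ fun t => (meanScale_pos f t).ne')).pow 2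

theorem hasDerivAt_noiseVar (hf : Continuous f) (hg : Continuous g) (t : ℝ) :
    HasDerivAt (noiseVar f g) (-2 * f t * noiseVar f g t + g t ^ 2) t := by
  refine (((hasDerivAt_meanScale hf t).fun_pow 2).fun_mul
    ((continuous_noise_integrand hf hg).integral_hasStrictDerivAt 0 t).hasDerivAt).congr_deriv ?_
  have := (meanScale_pos f t).ne'
  rw [noiseVar]
  field_simp
  ring

theorem noiseVar_pos (hf : Continuous f) (hg : Continuous g) (hg0 : ∀ t, 0 < g t) {t : ℝ}
    (ht : 0 < t) : 0 < noiseVar f g t :=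
  mul_pos (pow_pos (meanScale_pos f t) 2) <|
    intervalIntegral.intervalIntegral_pos_of_pos
      ((continuous_noise_integrand hf hg).intervalIntegrable _ _)
      (fun s => pow_pos (mul_pos (hg0 s) (inv_pos.2 (meanScale_pos f s))) 2) ht

/-- Pathwise solution of `dx = -f x dt + dz`: `exp (∫₀ᵗ f) x t - x 0` is the Riemann–Stieltjes
integral `∫₀ᵗ exp (∫₀ˢ f) dz s`. -/
theorem tendsto_sum_inv_meanScale_smul {F : Type*} [NormedAddCommGroup F] [NormedSpace ℝ F]
    [CompleteSpace F] (hf : Continuous f) {x : ℝ → F} {t : ℝ} (ht : 0 ≤ t)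
    (hx : ContinuousOn x (Icc 0 t)) {z : ℝ → F}
    (hz : ∀ s ∈ Icc 0 t, z s = x s - x 0 + ∫ r in (0 : ℝ)..s, f r • x r) :
    Tendsto (fun N : ℕ => ∑ k ∈ Finset.range N, (meanScale f ((k : ℝ) * t / N))⁻¹ •
      (z (((k : ℝ) + 1) * t / N) - z ((k : ℝ) * t / N))) atTop
      (𝓝 ((meanScale f t)⁻¹ • x t - x 0)) := by
  set b : ℝ → ℝ := fun s => (meanScale f s)⁻¹ with hb
  have hbc : Continuous b := (continuous_meanScale hf).inv₀ fun t => (meanScale_pos f t).ne'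
  have hbd : ∀ s, HasDerivAt b (f s * b s) s := fun s => by
    refine ((hasDerivAt_meanScale hf s).fun_inv (meanScale_pos f s).ne').congr_deriv ?_
    have := (meanScale_pos f s).ne'
    simp only [hb]
    field_simp
  obtain ⟨Cf, hCf⟩ := isCompact_Icc.exists_bound_of_continuousOn (s := Icc 0 t) hf.continuousOn
  obtain ⟨Cx, hCx⟩ := isCompact_Icc.exists_bound_of_continuousOn hx
  obtain ⟨Cb, hCb⟩ := isCompact_Icc.exists_bound_of_continuousOn (s := Icc 0 t) hbc.continuousOn
  have h0 : (0 : ℝ) ∈ Icc 0 t := ⟨le_rfl, ht⟩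
  have hCf0 := (norm_nonneg _).trans (hCf 0 h0)
  have hCx0 := (norm_nonneg _).trans (hCx 0 h0)
  have hCb0 := (norm_nonneg _).trans (hCb 0 h0)
  have hux := Metric.uniformContinuousOn_iff.1 (isCompact_Icc.uniformContinuousOn_of_continuous hx)
  have hub := Metric.uniformContinuousOn_iff.1
    (isCompact_Icc.uniformContinuousOn_of_continuous (s := Icc 0 t) hbc.continuousOn)
  -- the increment of `b • x` differs from `b s • (z s' - z s)` by an integral of small terms
  have hstep : ∀ s ∈ Icc 0 t, ∀ s' ∈ Icc 0 t, s ≤ s' →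
      b s • (z s' - z s) - (b s' • x s' - b s • x s) =
        ∫ r in s..s', f r • (b s • x r - b r • x s') := by
    intro s hs s' hs' hss'
    have hsub : uIcc s s' ⊆ Icc 0 t := by
      rw [uIcc_of_le hss']; exact Icc_subset_Icc hs.1 hs'.2
    have hint : ∀ p ∈ Icc 0 t, ∀ q ∈ Icc 0 t,
        IntervalIntegrable (fun r => f r • x r) volume p q := fun p hp q hq =>
      (hf.continuousOn.smul (hx.mono (by
        rw [← uIcc_of_le ht]
        exact uIcc_subset_uIcc (by rwa [uIcc_of_le ht]) (by rwa [uIcc_of_le ht])))).intervalIntegrable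
    have h1 : z s' - z s = x s' - x s + ∫ r in s..s', f r • x r := by
      rw [hz s hs, hz s' hs', ← intervalIntegral.integral_interval_sub_left
        (hint 0 h0 s' hs') (hint 0 h0 s hs)]
      abel
    have h2 : ∫ r in s..s', f r * b r = b s' - b s :=
      intervalIntegral.integral_eq_sub_of_hasDerivAt (fun r _ => hbd r)
        ((hf.mul hbc).intervalIntegrable _ _)
    have h3 : ∀ r, f r • (b s • x r - b r • x s') = b s • f r • x r - (f r * b r) • x s' := by
      intro r
      rw [smul_sub, smul_comm, mul_smul]
    simp_rw [h3]
    rw [intervalIntegral.integral_sub (f := fun r => b s • f r • x r)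
      (g := fun r => (f r * b r) • x s') ((hint s hs s' hs').smul (b s))
      (((hf.mul hbc).smul continuous_const).intervalIntegrable _ _), intervalIntegral.integral_smul,
      intervalIntegral.integral_smul_const, h2, h1]
    module
  rw [Metric.tendsto_atTop]
  intro ε hε
  set η := ε / ((t + 1) * (Cf + 1) * (Cx + Cb + 1)) with hη
  have hη0 : 0 < η := by positivity
  obtain ⟨δ₁, hδ₁, hδ₁'⟩ := hux η hη0
  obtain ⟨δ₂, hδ₂, hδ₂'⟩ := hub η hη0
  obtain ⟨N₀, hN₀⟩ := exists_nat_gt (t / min δ₁ δ₂)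
  refine ⟨N₀ + 1, fun N hN => ?_⟩
  have hN0 : (0 : ℝ) < N := by
    have : 0 < N := by omega
    exact_mod_cast this
  have hmesh : t / N < min δ₁ δ₂ := by
    have hmin : 0 < min δ₁ δ₂ := lt_min hδ₁ hδ₂
    rw [div_lt_iff₀ hmin] at hN₀
    rw [div_lt_iff₀ hN0]
    have : (N₀ : ℝ) ≤ N := by exact_mod_cast (by omega : N₀ ≤ N)
    nlinarith
  have htel : (meanScale f t)⁻¹ • x t - x 0 = ∑ k ∈ Finset.range N,
      (b (((k : ℝ) + 1) * t / N) • x (((k : ℝ) + 1) * t / N) -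
        b ((k : ℝ) * t / N) • x ((k : ℝ) * t / N)) := by
    have := Finset.sum_range_sub (fun k : ℕ => b ((k : ℝ) * t / N) • x ((k : ℝ) * t / N)) N
    push_cast at this
    rw [this, mul_div_cancel_left₀ _ hN0.ne']
    simp [hb, meanScale]
  rw [dist_eq_norm, htel, ← Finset.sum_sub_distrib]
  have hterm : ∀ k ∈ Finset.range N, ‖b ((k : ℝ) * t / N) •
      (z (((k : ℝ) + 1) * t / N) - z ((k : ℝ) * t / N)) -
      (b (((k : ℝ) + 1) * t / N) • x (((k : ℝ) + 1) * t / N) -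
        b ((k : ℝ) * t / N) • x ((k : ℝ) * t / N))‖ ≤ Cf * (η * (Cx + Cb)) * (t / N) := by
    intro k hk
    rw [Finset.mem_range] at hk
    have hs := grid_mem_Icc ht hk.le
    have hs' := grid_succ_mem_Icc ht hk
    have hlen : ((k : ℝ) + 1) * t / N - (k : ℝ) * t / N = t / N := by ring
    have hle : (k : ℝ) * t / N ≤ ((k : ℝ) + 1) * t / N := by
      have : 0 ≤ t / N := by positivity
      linarith
    set s := (k : ℝ) * t / N
    set s' := ((k : ℝ) + 1) * t / N
    rw [hstep s hs s' hs' hle]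
    refine (intervalIntegral.norm_integral_le_of_norm_le_const (C := Cf * (η * (Cx + Cb))) ?_).trans
      (by rw [hlen, abs_of_nonneg (by positivity)])
    intro r hr
    rw [uIoc_of_le hle] at hr
    have hr' : r ∈ Icc 0 t := ⟨hs.1.trans hr.1.le, hr.2.trans hs'.2⟩
    have hrs : dist s r < min δ₁ δ₂ := by
      rw [Real.dist_eq, abs_sub_comm, abs_of_nonneg (by linarith [hr.1])]
      linarith [hr.2]
    have hrs' : dist r s' < min δ₁ δ₂ := by
      rw [Real.dist_eq, abs_sub_comm, abs_of_nonneg (by linarith [hr.2])]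
      linarith [hr.1]
    rw [norm_smul]
    refine mul_le_mul (hCf r hr') ?_ (norm_nonneg _) hCf0
    have hdec : b s • x r - b r • x s' = (b s - b r) • x r + b r • (x r - x s') := by
      module
    rw [hdec, mul_add]
    refine (norm_add_le _ _).trans (add_le_add ?_ ?_)
    · rw [norm_smul, ← dist_eq_norm]
      exact mul_le_mul (hδ₂' s hs r hr' (hrs.trans_le (min_le_right _ _))).le (hCx r hr')
        (norm_nonneg _) hη0.le
    · rw [norm_smul, ← dist_eq_norm, mul_comm]
      exact mul_le_mul (hδ₁' r hr' s' hs' (hrs'.trans_le (min_le_left _ _))).le (hCb r hr')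
        (norm_nonneg _) hη0.le
  refine (norm_sum_le_of_le _ hterm).trans_lt ?_
  rw [Finset.sum_const, Finset.card_range, nsmul_eq_mul]
  have e1 : (N : ℝ) * (Cf * (η * (Cx + Cb)) * (t / N)) = t * Cf * (Cx + Cb) * η := by
    field_simp
  rw [e1]
  calc t * Cf * (Cx + Cb) * η < ((t + 1) * (Cf + 1) * (Cx + Cb + 1)) * η := by
        refine mul_lt_mul_of_pos_right ?_ hη0
        have a1 : t * Cf ≤ (t + 1) * (Cf + 1) := by nlinarith
        have a2 : 0 < (t + 1) * (Cf + 1) := by positivity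
        have a3 : 0 ≤ Cx + Cb := by positivity
        nlinarith
    _ = ε := by rw [hη]; field_simp

variable {n : ℕ} {Ω : Type*} [MeasurableSpace Ω] {P : Measure Ω}
  {W : ℝ≥0 → Ω → EuclideanSpace ℝ (Fin n)} {X : ℝ → Ω → EuclideanSpace ℝ (Fin n)} {T : ℝ}
  {p₀ : Measure (EuclideanSpace ℝ (Fin n))}

theorem IsForwardSolution.congr {f' g' : ℝ → ℝ} (hX : IsForwardSolution P f g T p₀ W X)
    (hf : EqOn f f' (Icc 0 T)) (hg : EqOn g g' (Icc 0 T)) :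
    IsForwardSolution P f' g' T p₀ W X where
  wiener := hX.wiener
  measurable := hX.measurable
  continuous_paths := hX.continuous_paths
  initial_law := hX.initial_law
  initial_indep := hX.initial_indep
  equation t ht := by
    have h := hX.equation t ht
    have h1 : ∀ m ω, stochRiemannSum g W t m ω = stochRiemannSum g' W t m ω := by
      intro m ω
      refine Finset.sum_congr rfl fun k hk => ?_
      rw [hg (Icc_subset_Icc_right ht.2 (grid_mem_Icc ht.1 (Finset.mem_range.1 hk).le))]
    have h2 : ∀ ω, ∫ s in (0 : ℝ)..t, f s • X s ω = ∫ s in (0 : ℝ)..t, f' s • X s ω := by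
      intro ω
      refine intervalIntegral.integral_congr fun s hs => ?_
      rw [uIcc_of_le ht.1] at hs
      simp only [hf (Icc_subset_Icc_right ht.2 hs)]
    simp only [IsItoIntegral, h1, h2] at h
    exact h

variable [IsProbabilityMeasure P]

/-- At time `t` the diffusion has the law of `meanScale f t • X 0` plus an independent centred
Gaussian vector with covariance `noiseVar f g t • 1`. -/
theorem IsForwardSolution.charFun_map (hX : IsForwardSolution P f g T p₀ W X)
    (hf : Continuous f) (hg : Continuous g) {t : ℝ} (ht : t ∈ Icc 0 T)
    (ξ : EuclideanSpace ℝ (Fin n)) :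
    charFun (P.map (X t)) ξ =
      charFun p₀ (meanScale f t • ξ) * Complex.exp (-(noiseVar f g t * ‖ξ‖ ^ 2 / 2 : ℝ)) := by
  set b : ℝ → ℝ := fun s => (meanScale f s)⁻¹ with hb
  have hbc : Continuous b := (continuous_meanScale hf).inv₀ fun t => (meanScale_pos f t).ne'
  set Z : ℝ → Ω → EuclideanSpace ℝ (Fin n) := fun t ω => X t ω - X 0 ω +
    ∫ s in (0 : ℝ)..t, f s • X s ω with hZ
  have hT : 0 ≤ T := ht.1.trans ht.2
  have hX0 : Measurable (X 0) := hX.measurable 0 ⟨le_rfl, hT⟩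
  have hinc := charFun_add_sum_increments hX.wiener hX0 hX.initial_indep hg ht.1 (Z := Z)
    (fun s hs => hX.equation s (Icc_subset_Icc_right ht.2 hs)) b
  have hlim : ∀ᵐ ω ∂P, Tendsto (fun N : ℕ => X 0 ω + ∑ k ∈ Finset.range N, b ((k : ℝ) * t / N) •
      (Z (((k : ℝ) + 1) * t / N) ω - Z ((k : ℝ) * t / N) ω)) atTop (𝓝 (b t • X t ω)) := by
    filter_upwards [hX.continuous_paths] with ω hω
    have h := tendsto_sum_inv_meanScale_smul hf ht.1 (hω.mono (Icc_subset_Icc_right ht.2))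
      (z := fun s => Z s ω) fun s _ => rfl
    simpa using h.const_add (X 0 ω)
  have h1 := tendsto_charFun_of_tendsto_ae (fun N => (hinc N).1) hlim (meanScale f t • ξ)
  simp_rw [fun N => (hinc N).2] at h1
  have hscale : charFun (P.map fun ω => b t • X t ω) (meanScale f t • ξ) =
      charFun (P.map (X t)) ξ := by
    have := (hX.measurable t ht).aemeasurable (μ := P)
    rw [charFun_apply, charFun_apply, integral_map (φ := fun ω => b t • X t ω) (by fun_prop)
      (by fun_prop), integral_map this (by fun_prop)]
    have hne := (meanScale_pos f t).ne'
    simp only [real_inner_smul_left, real_inner_smul_right, hb, ← mul_assoc, mul_inv_cancel₀ hne,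
      one_mul]
  rw [hscale, hX.initial_law] at h1
  refine tendsto_nhds_unique h1 (Tendsto.const_mul _ ?_)
  have h2 : Tendsto (fun N => ∫ s, (g s * gridStep b t N s) ^ 2) atTop
      (𝓝 (∫ s in (0 : ℝ)..t, (g s * b s) ^ 2)) := by
    obtain ⟨Cb, hCb⟩ := isCompact_Icc.exists_bound_of_continuousOn (s := Icc 0 t) hbc.continuousOn
    obtain ⟨Cg, hCg⟩ := isCompact_Icc.exists_bound_of_continuousOn (s := Icc 0 t) hg.continuousOn
    rw [intervalIntegral.integral_of_le ht.1, ← integral_indicator measurableSet_Ioc]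
    refine tendsto_integral_of_dominated_convergence ((Ioc 0 t).indicator fun _ => (Cg * Cb) ^ 2)
      (fun m => ?_) ?_ (fun m => ae_of_all _ fun s => ?_) (ae_of_all _ fun s => ?_)
    · exact ((hg.measurable.mul (measurable_gridStep _ _ _)).pow_const 2).aestronglyMeasurable
    · rw [integrable_indicator_iff measurableSet_Ioc]
      exact integrableOn_const (by simp)
    · have hg' := abs_gridStep_le ht.1 hCb m s
      by_cases hs : s ∈ Ioc 0 t
      · rw [indicator_of_mem hs] at hg' ⊢
        rw [norm_pow, norm_mul]
        have := hCg s (Ioc_subset_Icc_self hs)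
        refine pow_le_pow_left₀ (by positivity) ?_ 2
        exact mul_le_mul this hg' (norm_nonneg _) ((norm_nonneg _).trans this)
      · rw [gridStep_of_notMem ht.1 m hs, indicator_of_notMem hs]
        simp
    · have h := ((tendsto_gridStep hbc ht.1 s).const_mul (g s)).pow 2
      convert h using 2
      by_cases hs : s ∈ Ioc 0 t <;> simp [hs]
  have hcont : Continuous fun v : ℝ => Complex.exp (-(v * ‖meanScale f t • ξ‖ ^ 2 / 2 : ℝ)) := by
    fun_prop
  have h3 := (hcont.tendsto _).comp h2
  have h4 : (∫ s in (0 : ℝ)..t, (g s * b s) ^ 2) * ‖meanScale f t • ξ‖ ^ 2 / 2 =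
      noiseVar f g t * ‖ξ‖ ^ 2 / 2 := by
    rw [norm_smul, Real.norm_of_nonneg (meanScale_pos f t).le, noiseVar]
    ring
  rw [h4] at h3
  exact h3

end LinearSDE

/-! ### The probability flow of a Gaussian mixture -/

section ProbabilityFlow

variable {n : ℕ} {ι : Type*} [Fintype ι] [Nonempty ι] {x₀ : ι → EuclideanSpace ℝ (Fin n)}
  {f g m V : ℝ → ℝ} {ε T : ℝ}

variable (x₀ f g m V) in
/-- The space derivative of the velocity of the probability flow of a Gaussian mixture. -/
noncomputable def flowVelocityDeriv (t : ℝ) (x : EuclideanSpace ℝ (Fin n)) :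
    EuclideanSpace ℝ (Fin n) →L[ℝ] EuclideanSpace ℝ (Fin n) :=
  -(f t • ContinuousLinearMap.id ℝ _) - (g t ^ 2 / 2) • mixScoreDeriv x₀ (m t) (V t) x

theorem hasFDerivAt_flowVelocity {t : ℝ} (hVt : 0 < V t) (x : EuclideanSpace ℝ (Fin n)) :
    HasFDerivAt (flowVelocity f g (fun x t => mixScore x₀ (m t) (V t) x) t)
      (flowVelocityDeriv x₀ f g m V t x) x :=
  ((hasFDerivAt_id x).const_smul (f t)).fun_neg.fun_sub
    ((hasFDerivAt_mixScore hVt x).const_smul (g t ^ 2 / 2))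

theorem exists_lipschitzWith_flowVelocity (hf : Continuous f) (hg : Continuous g)
    (hm : Continuous m) (hV : Continuous V) (hV0 : ∀ t ∈ Icc ε T, 0 < V t) :
    ∃ K : ℝ≥0, ∀ t ∈ Icc ε T,
      LipschitzWith K (flowVelocity f g (fun x t => mixScore x₀ (m t) (V t) x) t) := by
  obtain ⟨R, hR⟩ : ∃ R, ∀ i, ‖x₀ i‖ ≤ R := (Finite.bddAbove_range fun i => ‖x₀ i‖).imp
    fun R hR i => hR ⟨i, rfl⟩
  have hc : ContinuousOn (fun t => |f t| + g t ^ 2 / 2 * (2 * (|m t| * R / V t) ^ 2 + 1 / V t))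
      (Icc ε T) := by
    have h1 : ∀ t ∈ Icc ε T, V t ≠ 0 := fun t ht => (hV0 t ht).ne'
    fun_prop (disch := assumption)
  obtain ⟨K, hK⟩ := isCompact_Icc.exists_bound_of_continuousOn hc
  refine ⟨K.toNNReal, fun t ht => ?_⟩
  refine lipschitzWith_of_nnnorm_fderiv_le
    (fun x => (hasFDerivAt_flowVelocity (hV0 t ht) x).differentiableAt) fun x => ?_
  rw [(hasFDerivAt_flowVelocity (hV0 t ht) x).fderiv, ← NNReal.coe_le_coe, coe_nnnorm]
  refine le_trans ?_ ((le_abs_self _).trans ((hK t ht).trans (Real.le_coe_toNNReal K)))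
  refine (norm_sub_le _ _).trans (add_le_add ?_ ?_)
  · rw [norm_neg, norm_smul, Real.norm_eq_abs]
    exact mul_le_of_le_one_right (abs_nonneg _) ContinuousLinearMap.norm_id_le
  · rw [norm_smul, Real.norm_of_nonneg (by positivity)]
    gcongr
    exact norm_mixScoreDeriv_le (hV0 t ht) hR x

/-- Reversal of time turns trajectories starting at time `T` into trajectories starting at `0`. -/
theorem IsIntegralCurveOn.time_reversal {E : Type*} [NormedAddCommGroup E] [NormedSpace ℝ E]
    {γ : ℝ → E} {v : ℝ → E → E} (h : IsIntegralCurveOn γ v (Icc ε T)) :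
    IsIntegralCurveOn (fun s => γ (T - s)) (fun s x => -v (T - s) x) (Icc 0 (T - ε)) := by
  intro s hs
  have hmaps : MapsTo (fun s => T - s) (Icc 0 (T - ε)) (Icc ε T) := fun r hr =>
    ⟨by linarith [hr.2], by linarith [hr.1]⟩
  have := (h (T - s) (hmaps hs)).scomp s
    (((hasDerivAt_id s).const_sub T).hasDerivWithinAt (s := Icc 0 (T - ε))) hmaps
  simpa [Function.comp_def] using this

theorem continuous_flow_projIcc {E : Type*} [NormedAddCommGroup E] [NormedSpace ℝ E]
    {v : ℝ → E → E} {K : ℝ≥0} {Φ : E → ℝ → E} (hεT : ε ≤ T)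
    (hK : ∀ t ∈ Icc ε T, LipschitzWith K (v t))
    (hΦ : ∀ x, IsIntegralCurveOn (Φ x) v (Icc ε T)) (hΦT : ∀ x, Φ x T = x) :
    Continuous fun z : E × ℝ => Φ z.1 (projIcc ε T hεT z.2) := by
  refine continuous_prod_of_continuous_lipschitzWith _ (Real.toNNReal (Real.exp (K * (T - ε))))
    (fun x => ?_) fun t => LipschitzWith.of_dist_le_mul fun x y => ?_
  · exact ((hΦ x).continuousOn').comp_continuous
      (continuous_subtype_val.comp continuous_projIcc) fun t => (projIcc ε T hεT t).2
  · rw [Real.coe_toNNReal _ (Real.exp_pos _).le]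
    have := dist_flow_le (v := fun s x => -v (T - s) x) (K := K) (b := T - ε)
      (Φ := fun x s => Φ x (T - s)) (t := T - projIcc ε T hεT t)
      (fun s hs => (hK (T - s) ⟨by linarith [hs.2], by linarith [hs.1]⟩).neg)
      (fun x => (hΦ x).time_reversal) (by simpa using hΦT)
      ⟨by linarith [(projIcc ε T hεT t).2.2], by linarith [(projIcc ε T hεT t).2.1]⟩ x y
    simpa using this

/-- The probability flow transports the mixture at time `T` to the mixture at time `t`, in the form
of an inequality which suffices for upper bounds. -/
theorem lintegral_comp_probabilityFlow_le (hf : Continuous f) (hg : Continuous g)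
    (hm : ∀ t, HasDerivAt m (-f t * m t) t) (hV : ∀ t, HasDerivAt V (-2 * f t * V t + g t ^ 2) t)
    (hV0 : ∀ t ∈ Icc ε T, 0 < V t) {Φ : EuclideanSpace ℝ (Fin n) → ℝ → EuclideanSpace ℝ (Fin n)}
    (hΦ : ∀ x, IsIntegralCurveOn (Φ x)
      (flowVelocity f g (fun x t => mixScore x₀ (m t) (V t) x)) (Icc ε T))
    (hΦT : ∀ x, Φ x T = x) {t : ℝ} (ht : t ∈ Icc ε T) (F : EuclideanSpace ℝ (Fin n) → ℝ≥0∞) :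
    ∫⁻ x, F (Φ x t) * ENNReal.ofReal (mixDensity x₀ (m T) (V T) x) ≤
      ∫⁻ x, F x * ENNReal.ofReal (mixDensity x₀ (m t) (V t) x) := by
  have hmc : Continuous m := continuous_iff_continuousAt.2 fun t => (hm t).continuousAt
  have hVc : Continuous V := continuous_iff_continuousAt.2 fun t => (hV t).continuousAt
  obtain ⟨K, hK⟩ := exists_lipschitzWith_flowVelocity (x₀ := x₀) hf hg hmc hVc hV0
  have hmaps : ∀ s ∈ Icc 0 (T - ε), T - s ∈ Icc ε T := fun s hs =>
    ⟨by linarith [hs.2], by linarith [hs.1]⟩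
  have key := lintegral_comp_flow_le (E := EuclideanSpace ℝ (Fin n)) volume (b := T - ε) (K := K)
    (v := fun s x => -flowVelocity f g (fun x t => mixScore x₀ (m t) (V t) x) (T - s) x)
    (v' := fun s x => -flowVelocityDeriv x₀ f g m V (T - s) x)
    (Φ := fun x s => Φ x (T - s)) (ρ := fun s x => mixDensity x₀ (m (T - s)) (V (T - s)) x)
    (by linarith [ht.1, ht.2])
    (fun s hs x => (hasFDerivAt_flowVelocity (hV0 _ (hmaps s hs)) x).fun_neg) ?_
    (fun s hs => (hK _ (hmaps s hs)).neg) (fun x => (hΦ x).time_reversal) (by simpa using hΦT)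
    (fun s hs x => (mixDensity_pos (hV0 _ (hmaps s hs)) x).le) ?_ (t := T - t)
    ⟨by linarith [ht.2], by linarith [ht.1]⟩ F
  · simpa using key
  · have hD := continuousOn_mixScoreDeriv x₀ (X := ℝ × EuclideanSpace ℝ (Fin n))
      (s := Icc 0 (T - ε) ×ˢ univ) (m := fun z => m (T - z.1)) (V := fun z => V (T - z.1))
      (x := fun z => z.2) (by fun_prop) (by fun_prop) continuousOn_snd
      fun z hz => hV0 _ (hmaps _ hz.1)
    have hf' : ContinuousOn (fun z : ℝ × EuclideanSpace ℝ (Fin n) => f (T - z.1) •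
        ContinuousLinearMap.id ℝ (EuclideanSpace ℝ (Fin n))) (Icc 0 (T - ε) ×ˢ univ) := by
      fun_prop
    have hg' : ContinuousOn (fun z : ℝ × EuclideanSpace ℝ (Fin n) => g (T - z.1) ^ 2 / 2)
        (Icc 0 (T - ε) ×ˢ univ) := by
      fun_prop
    exact (hf'.neg.sub (hg'.smul hD)).neg
  · intro x s hs
    have hVs := hV0 _ (hmaps s hs)
    have h1 := hasDerivWithinAt_mixDensity_comp (x₀ := x₀) (γ := Φ x) (s := Icc ε T) hVs
      (hm (T - s)).hasDerivWithinAt (hV (T - s)).hasDerivWithinAt (hΦ x (T - s) (hmaps s hs))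
    have h2 := h1.scomp s (((hasDerivAt_id s).const_sub T).hasDerivWithinAt
      (s := Icc 0 (T - ε))) hmaps
    refine h2.congr_deriv ?_
    simp [flowVelocityDeriv]
    ring

end ProbabilityFlow

/-! ### Stability of the flow under perturbation of the score -/

section Stability

open scoped RealInnerProductSpace

variable {n : ℕ} {f g L I : ℝ → ℝ} {ε T : ℝ}
  {s S : EuclideanSpace ℝ (Fin n) → ℝ → EuclideanSpace ℝ (Fin n)}
  {γ δ : ℝ → EuclideanSpace ℝ (Fin n)}

/-- Grönwall's inequality backwards in time, with the integrating factor `I`: the distance of two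
trajectories which agree at time `T` is controlled by the defect of the scores along the first. -/
theorem ofReal_mul_enorm_sub_le (hεT : ε ≤ T) (hf0 : ∀ t ∈ Icc ε T, 0 ≤ f t)
    (hg : ContinuousOn g (Icc ε T)) (hL0 : ∀ t ∈ Icc ε T, 0 ≤ L t)
    (hL : ∀ t ∈ Icc ε T, ∀ x y, ‖S x t - S y t‖ ≤ L t * ‖x - y‖)
    (hI0 : ∀ t, 0 < I t) (hIc : ContinuousOn I (Icc ε T))
    (hI : ∀ t ∈ Ioo ε T, HasDerivAt I ((f t + g t ^ 2 / 2 * L t) * I t) t)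
    (hγ : IsIntegralCurveOn γ (flowVelocity f g s) (Icc ε T))
    (hδ : IsIntegralCurveOn δ (flowVelocity f g S) (Icc ε T)) (hT : γ T = δ T)
    (hmeas : AEStronglyMeasurable (fun t => S (γ t) t - s (γ t) t) (volume.restrict (Icc ε T))) :
    ENNReal.ofReal (I ε) * ‖γ ε - δ ε‖ₑ ≤
      ∫⁻ t in Icc ε T, ENNReal.ofReal (g t ^ 2 / 2 * I t) * ‖S (γ t) t - s (γ t) t‖ₑ := by
  set h : ℝ → ℝ := fun t => g t ^ 2 / 2 * I t * ‖S (γ t) t - s (γ t) t‖ with hh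
  have hh0 : ∀ t, 0 ≤ h t := fun t => by have := hI0 t; positivity
  have hhR : ∀ t, ENNReal.ofReal (g t ^ 2 / 2 * I t) * ‖S (γ t) t - s (γ t) t‖ₑ =
      ENNReal.ofReal (h t) := fun t => by
    have := hI0 t
    rw [← ofReal_norm, ← ENNReal.ofReal_mul (by positivity)]
  simp_rw [hhR]
  have hhm : AEStronglyMeasurable h (volume.restrict (Icc ε T)) := by
    refine AEStronglyMeasurable.mul ?_ hmeas.norm
    exact ContinuousOn.aestronglyMeasurable (by fun_prop) measurableSet_Icc
  rcases eq_or_ne (∫⁻ t in Icc ε T, ENNReal.ofReal (h t)) ⊤ with htop | htop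
  · rw [htop]; exact le_top
  have hint : IntegrableOn h (Icc ε T) := by
    refine ⟨hhm, ?_⟩
    rw [hasFiniteIntegral_iff_ofReal (ae_of_all _ hh0)]
    exact htop.lt_top
  rw [← ofReal_integral_eq_lintegral_ofReal hint (ae_of_all _ hh0), ← ofReal_norm,
    ← ENNReal.ofReal_mul (hI0 ε).le]
  refine ENNReal.ofReal_le_ofReal (le_of_forall_pos_le_add fun κ hκ => ?_)
  -- the norm of the difference is not differentiable at its zeros, so it is regularized
  set η : ℝ := κ / I T with hη
  have hη0 : 0 < η := div_pos hκ (hI0 T)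
  set e : ℝ → EuclideanSpace ℝ (Fin n) := fun t => γ t - δ t with he
  set N : ℝ → ℝ := fun t => √(‖e t‖ ^ 2 + η ^ 2) with hN
  have hpos : ∀ t, 0 < ‖e t‖ ^ 2 + η ^ 2 := fun t => by positivity
  have hN0 : ∀ t, 0 < N t := fun t => Real.sqrt_pos.2 (hpos t)
  have hNe : ∀ t, ‖e t‖ ≤ N t := fun t =>
    Real.le_sqrt_of_sq_le (by nlinarith [sq_nonneg η])
  have hec : ContinuousOn e (Icc ε T) := hγ.continuousOn'.sub hδ.continuousOn'
  have hNc : ContinuousOn N (Icc ε T) := by fun_prop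
  set e' : ℝ → EuclideanSpace ℝ (Fin n) := fun t =>
    flowVelocity f g s t (γ t) - flowVelocity f g S t (δ t) with he'
  have hder : ∀ t ∈ Ioo ε T, HasDerivAt (fun t => -(I t * N t))
      (-((f t + g t ^ 2 / 2 * L t) * I t * N t + I t * (⟪e t, e' t⟫ / N t))) t := by
    intro t ht
    have hnhds := Icc_mem_nhds ht.1 ht.2
    have h1 : HasDerivAt e (e' t) t :=
      ((hγ t (Ioo_subset_Icc_self ht)).hasDerivAt hnhds).sub
        ((hδ t (Ioo_subset_Icc_self ht)).hasDerivAt hnhds)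
    have h2 : HasDerivAt N (⟪e t, e' t⟫ / N t) t := by
      refine ((h1.norm_sq.add_const (η ^ 2)).sqrt (hpos t).ne').congr_deriv ?_
      have := (hN0 t).ne'
      rw [mul_div_mul_left _ _ two_ne_zero]
    exact ((hI t ht).fun_mul h2).fun_neg
  have hbound : ∀ t ∈ Ioo ε T,
      -((f t + g t ^ 2 / 2 * L t) * I t * N t + I t * (⟪e t, e' t⟫ / N t)) ≤ h t := by
    intro t ht
    have ht' := Ioo_subset_Icc_self ht
    have hf := hf0 t ht'
    have hLt := hL0 t ht'
    have hinner : -⟪e t, e' t⟫ ≤ (f t + g t ^ 2 / 2 * L t) * ‖e t‖ ^ 2 +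
        g t ^ 2 / 2 * ‖e t‖ * ‖S (γ t) t - s (γ t) t‖ := by
      have h1 : -e' t = f t • e t + (g t ^ 2 / 2) • ((s (γ t) t - S (γ t) t) +
          (S (γ t) t - S (δ t) t)) := by
        simp only [he', he, flowVelocity]
        module
      rw [← inner_neg_right, h1, inner_add_right, inner_smul_right, inner_smul_right,
        inner_add_right, real_inner_self_eq_norm_sq]
      have h2 := real_inner_le_norm (e t) (s (γ t) t - S (γ t) t)
      have h3 := real_inner_le_norm (e t) (S (γ t) t - S (δ t) t)
      have h4 : ‖e t‖ * ‖S (γ t) t - S (δ t) t‖ ≤ ‖e t‖ * (L t * ‖e t‖) :=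
        mul_le_mul_of_nonneg_left (hL t ht' _ _) (norm_nonneg _)
      rw [norm_sub_rev (s (γ t) t)] at h2
      have h5 := mul_le_mul_of_nonneg_left (add_le_add h2 (h3.trans h4))
        (by positivity : 0 ≤ g t ^ 2 / 2)
      linarith
    have hdiv : -(⟪e t, e' t⟫ / N t) ≤ (f t + g t ^ 2 / 2 * L t) * N t +
        g t ^ 2 / 2 * ‖S (γ t) t - s (γ t) t‖ := by
      rw [← neg_div, div_le_iff₀ (hN0 t)]
      refine hinner.trans ?_
      have h1 : (f t + g t ^ 2 / 2 * L t) * ‖e t‖ ^ 2 ≤ (f t + g t ^ 2 / 2 * L t) * N t ^ 2 := by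
        have := hNe t
        gcongr
      have h2 : g t ^ 2 / 2 * ‖e t‖ * ‖S (γ t) t - s (γ t) t‖ ≤
          g t ^ 2 / 2 * N t * ‖S (γ t) t - s (γ t) t‖ := by
        have := hNe t
        gcongr
      linarith
    have := mul_le_mul_of_nonneg_left hdiv (hI0 t).le
    simp only [hh]
    linarith
  have hFTC := intervalIntegral.sub_le_integral_of_hasDeriv_right_of_le hεT
    (g := fun t => -(I t * N t)) (hIc.mul hNc).fun_neg
    (fun t ht => (hder t ht).hasDerivWithinAt) hint hbound
  rw [intervalIntegral.integral_of_le hεT, ← integral_Icc_eq_integral_Ioc] at hFTC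
  have hNT : N T = η := by simp [hN, he, hT, hη0.le]
  have hIT : I T * N T = κ := by rw [hNT, hη, mul_div_cancel₀ _ (hI0 T).ne']
  have h1 : I ε * ‖γ ε - δ ε‖ ≤ I ε * N ε := mul_le_mul_of_nonneg_left (hNe ε) (hI0 ε).le
  linarith

theorem sq_lintegral_le {α : Type*} [MeasurableSpace α] {μ : Measure α} {h : α → ℝ≥0∞}
    (hh : AEMeasurable h μ) : (∫⁻ a, h a ∂μ) ^ 2 ≤ μ univ * ∫⁻ a, h a ^ 2 ∂μ := by
  have := ENNReal.lintegral_mul_le_Lp_mul_Lq μ Real.HolderConjugate.two_two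
    (f := fun _ => 1) aemeasurable_const hh
  simp only [Pi.mul_apply, one_mul, ENNReal.one_rpow, lintegral_one] at this
  calc (∫⁻ a, h a ∂μ) ^ 2 ≤ (μ univ ^ (1 / 2 : ℝ) * (∫⁻ a, h a ^ (2 : ℝ) ∂μ) ^ (1 / 2 : ℝ)) ^ 2 := by
        gcongr
    _ = μ univ * ∫⁻ a, h a ^ 2 ∂μ := by
        rw [mul_pow, ← ENNReal.rpow_natCast, ← ENNReal.rpow_natCast, ← ENNReal.rpow_mul,
          ← ENNReal.rpow_mul]
        simp

variable {f g L : ℝ → ℝ}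

theorem intervalIntegrable_rate (hεT : ε < T)
    (hf : Continuous f) (hg : Continuous g) (hLc : ContinuousOn L (Icc ε T))
    (hLi : IntervalIntegrable L volume 0 ε) :
    IntervalIntegrable (fun τ => f τ + g τ ^ 2 / 2 * L τ) volume 0 T := by
  refine (hf.intervalIntegrable _ _).add (IntervalIntegrable.continuousOn_mul ?_ (by fun_prop))
  refine hLi.trans (ContinuousOn.intervalIntegrable ?_)
  rwa [uIcc_of_le hεT.le]

theorem continuousOn_integratingFactor (hε : 0 < ε) (hεT : ε < T)
    (hf : Continuous f) (hg : Continuous g) (hLc : ContinuousOn L (Icc ε T))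
    (hLi : IntervalIntegrable L volume 0 ε) :
    ContinuousOn (integratingFactor f g L) (Icc ε T) := by
  have hT : 0 ≤ T := (hε.trans hεT).le
  have h := intervalIntegral.continuousOn_primitive_interval'
    (intervalIntegrable_rate hεT hf hg hLc hLi) (left_mem_uIcc)
  rw [uIcc_of_le hT] at h
  exact Real.continuous_exp.comp_continuousOn (h.mono (Icc_subset_Icc_left hε.le))

theorem hasDerivAt_integratingFactor (hε : 0 < ε) (hεT : ε < T)
    (hf : Continuous f) (hg : Continuous g) (hLc : ContinuousOn L (Icc ε T))
    (hLi : IntervalIntegrable L volume 0 ε) {t : ℝ} (ht : t ∈ Ioo ε T) :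
    HasDerivAt (integratingFactor f g L)
      ((f t + g t ^ 2 / 2 * L t) * integratingFactor f g L t) t := by
  have hc : ContinuousOn (fun τ => f τ + g τ ^ 2 / 2 * L τ) (Ioo ε T) := by
    have := hLc.mono Ioo_subset_Icc_self
    fun_prop
  have hi : IntervalIntegrable (fun τ => f τ + g τ ^ 2 / 2 * L τ) volume 0 t :=
    (intervalIntegrable_rate hεT hf hg hLc hLi).mono_set (by
      rw [uIcc_of_le (hε.trans ht.1).le, uIcc_of_le (hε.trans hεT).le]
      exact Icc_subset_Icc_right ht.2.le)
  refine (intervalIntegral.integral_hasDerivAt_right hi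
    (hc.stronglyMeasurableAtFilter isOpen_Ioo t ht)
    (hc.continuousAt (isOpen_Ioo.mem_nhds ht))).exp.congr_deriv ?_
  rw [integratingFactor, mul_comm]

end Stability

/-! ### The flow maps differ by at most the score matching loss -/

theorem IsIntegralCurveOn.congr_velocity {E : Type*} [NormedAddCommGroup E] [NormedSpace ℝ E]
    {γ : ℝ → E} {v v' : ℝ → E → E} {s : Set ℝ} (h : IsIntegralCurveOn γ v s)
    (hv : ∀ t ∈ s, ∀ x, v t x = v' t x) : IsIntegralCurveOn γ v' s := fun t ht => by
  rw [← hv t ht]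
  exact h t ht

section FlowComparison

variable {n : ℕ} {ι : Type*} [Fintype ι] [Nonempty ι] {x₀ : ι → EuclideanSpace ℝ (Fin n)}
  {f g m V I L : ℝ → ℝ} {ε T : ℝ} {S : EuclideanSpace ℝ (Fin n) → ℝ → EuclideanSpace ℝ (Fin n)}
  {Φ Ψ : EuclideanSpace ℝ (Fin n) → ℝ → EuclideanSpace ℝ (Fin n)}

/-- The defect of a measurable score along the probability flow, with time clamped to `[ε, T]`,
is jointly measurable, as Tonelli's theorem needs. -/
theorem measurable_scoreDefect (hεT : ε ≤ T) (hf : Continuous f) (hg : Continuous g)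
    (hm : Continuous m) (hV : Continuous V) (hV0 : ∀ t ∈ Icc ε T, 0 < V t)
    (hS : Measurable (fun z : EuclideanSpace ℝ (Fin n) × ℝ => S z.1 z.2))
    (hΦ : ∀ x, IsIntegralCurveOn (Φ x)
      (flowVelocity f g (fun x t => mixScore x₀ (m t) (V t) x)) (Icc ε T))
    (hΦT : ∀ x, Φ x T = x) :
    Measurable fun z : EuclideanSpace ℝ (Fin n) × ℝ =>
      S (Φ z.1 (projIcc ε T hεT z.2)) (projIcc ε T hεT z.2) -
        mixScore x₀ (m (projIcc ε T hεT z.2)) (V (projIcc ε T hεT z.2))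
          (Φ z.1 (projIcc ε T hεT z.2)) := by
  obtain ⟨K, hK⟩ := exists_lipschitzWith_flowVelocity (x₀ := x₀) hf hg hm hV hV0
  have hΦc : Continuous fun z : EuclideanSpace ℝ (Fin n) × ℝ => Φ z.1 (projIcc ε T hεT z.2) :=
    continuous_flow_projIcc hεT hK hΦ hΦT
  have hτ : Continuous fun z : EuclideanSpace ℝ (Fin n) × ℝ => (projIcc ε T hεT z.2 : ℝ) :=
    continuous_subtype_val.comp (continuous_projIcc.comp continuous_snd)
  refine (hS.comp (hΦc.measurable.prodMk hτ.measurable)).sub (Continuous.measurable ?_)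
  rw [← continuousOn_univ]
  exact continuousOn_mixScore x₀ (m := fun z : EuclideanSpace ℝ (Fin n) × ℝ =>
      m (projIcc ε T hεT z.2)) (V := fun z => V (projIcc ε T hεT z.2))
    (hm.comp hτ).continuousOn (hV.comp hτ).continuousOn hΦc.continuousOn
    fun z _ => hV0 _ (projIcc ε T hεT z.2).2

/-- The comparison of the two flows, with the marginals written as explicit Gaussian mixtures. -/
theorem lintegral_sq_enorm_flow_sub_le (hεT : ε ≤ T) (hf : Continuous f) (hg : Continuous g)
    (hm : ∀ t, HasDerivAt m (-f t * m t) t) (hV : ∀ t, HasDerivAt V (-2 * f t * V t + g t ^ 2) t)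
    (hV0 : ∀ t ∈ Icc ε T, 0 < V t) (hf0 : ∀ t ∈ Icc ε T, 0 ≤ f t)
    (hS : Measurable (fun z : EuclideanSpace ℝ (Fin n) × ℝ => S z.1 z.2))
    (hL0 : ∀ t ∈ Icc ε T, 0 ≤ L t) (hL : ∀ t ∈ Icc ε T, ∀ x y, ‖S x t - S y t‖ ≤ L t * ‖x - y‖)
    (hI0 : ∀ t, 0 < I t) (hIc : ContinuousOn I (Icc ε T))
    (hI : ∀ t ∈ Ioo ε T, HasDerivAt I ((f t + g t ^ 2 / 2 * L t) * I t) t)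
    (hΦ : ∀ x, IsIntegralCurveOn (Φ x)
      (flowVelocity f g (fun x t => mixScore x₀ (m t) (V t) x)) (Icc ε T))
    (hΦT : ∀ x, Φ x T = x) (hΨ : ∀ x, IsIntegralCurveOn (Ψ x) (flowVelocity f g S) (Icc ε T))
    (hΨT : ∀ x, Ψ x T = x) :
    ENNReal.ofReal (I ε) ^ 2 *
        ∫⁻ x, ‖Φ x ε - Ψ x ε‖ₑ ^ 2 * ENNReal.ofReal (mixDensity x₀ (m T) (V T) x) ≤
      ENNReal.ofReal (T - ε) * ∫⁻ t in Icc ε T, ENNReal.ofReal (g t ^ 2 / 2 * I t) ^ 2 *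
        ∫⁻ x, ‖S x t - mixScore x₀ (m t) (V t) x‖ₑ ^ 2 *
          ENNReal.ofReal (mixDensity x₀ (m t) (V t) x) := by
  have hmc : Continuous m := continuous_iff_continuousAt.2 fun t => (hm t).continuousAt
  have hVc : Continuous V := continuous_iff_continuousAt.2 fun t => (hV t).continuousAt
  obtain ⟨D, hDm, hD⟩ : ∃ D : EuclideanSpace ℝ (Fin n) × ℝ → EuclideanSpace ℝ (Fin n),
      Measurable D ∧ ∀ x, ∀ t ∈ Icc ε T,
        D (x, t) = S (Φ x t) t - mixScore x₀ (m t) (V t) (Φ x t) :=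
    ⟨_, measurable_scoreDefect hεT hf hg hmc hVc hV0 hS hΦ hΦT, fun x t ht => by
      simp only [projIcc_of_mem hεT ht]⟩
  obtain ⟨w, hw⟩ : ∃ w : ℝ → ℝ≥0∞, ∀ t, w t = ENNReal.ofReal (g t ^ 2 / 2 * I t) :=
    ⟨_, fun _ => rfl⟩
  have hwm : AEMeasurable w (volume.restrict (Icc ε T)) := by
    rw [funext hw]
    refine AEMeasurable.ennreal_ofReal (ContinuousOn.aemeasurable ?_ measurableSet_Icc)
    fun_prop
  have hpath : ∀ x, ENNReal.ofReal (I ε) * ‖Φ x ε - Ψ x ε‖ₑ ≤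
      ∫⁻ t in Icc ε T, w t * ‖D (x, t)‖ₑ := by
    intro x
    have hDx : AEStronglyMeasurable
        (fun t => S (Φ x t) t - mixScore x₀ (m t) (V t) (Φ x t)) (volume.restrict (Icc ε T)) := by
      refine (hDm.comp (measurable_prodMk_left (x := x))).aestronglyMeasurable.congr ?_
      filter_upwards [ae_restrict_mem measurableSet_Icc] with t ht using hD x t ht
    refine (ofReal_mul_enorm_sub_le hεT hf0 hg.continuousOn hL0 hL hI0 hIc hI
      (hΦ x) (hΨ x) (by rw [hΦT, hΨT]) hDx).trans_eq ?_
    refine setLIntegral_congr_fun measurableSet_Icc fun t ht => ?_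
    simp only [hw, hD x t ht]
  -- the density is put into the measure, which makes Tonelli's theorem applicable as it stands
  obtain ⟨q, hq, hqF⟩ : ∃ q : Measure (EuclideanSpace ℝ (Fin n)), SFinite q ∧
      ∀ F : EuclideanSpace ℝ (Fin n) → ℝ≥0∞,
        ∫⁻ x, F x ∂q = ∫⁻ x, F x * ENNReal.ofReal (mixDensity x₀ (m T) (V T) x) := by
    refine ⟨volume.withDensity fun x => ENNReal.ofReal (mixDensity x₀ (m T) (V T) x),
      inferInstance, fun F => ?_⟩
    rw [lintegral_withDensity_eq_lintegral_mul_non_measurable _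
      (continuous_mixDensity (hV0 T ⟨hεT, le_rfl⟩)).measurable.ennreal_ofReal (by simp)]
    simp only [Pi.mul_apply, mul_comm]
  calc ENNReal.ofReal (I ε) ^ 2 *
        ∫⁻ x, ‖Φ x ε - Ψ x ε‖ₑ ^ 2 * ENNReal.ofReal (mixDensity x₀ (m T) (V T) x)
      = ∫⁻ x, (ENNReal.ofReal (I ε) * ‖Φ x ε - Ψ x ε‖ₑ) ^ 2 ∂q := by
        simp_rw [mul_pow]
        rw [lintegral_const_mul' _ _ (by simp), hqF]
    _ ≤ ∫⁻ x, ENNReal.ofReal (T - ε) * (∫⁻ t in Icc ε T, (w t * ‖D (x, t)‖ₑ) ^ 2) ∂q := by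
        refine lintegral_mono fun x => (pow_le_pow_left' (hpath x) 2).trans ?_
        have := sq_lintegral_le (hwm.mul
          (hDm.comp (measurable_prodMk_left (x := x))).enorm.aemeasurable)
        simpa using this
    _ = ENNReal.ofReal (T - ε) *
        ∫⁻ x, (∫⁻ t in Icc ε T, (w t * ‖D (x, t)‖ₑ) ^ 2) ∂q :=
        lintegral_const_mul' _ _ (by simp)
    _ = ENNReal.ofReal (T - ε) *
        ∫⁻ t in Icc ε T, (∫⁻ x, (w t * ‖D (x, t)‖ₑ) ^ 2 ∂q) := by
        rw [lintegral_lintegral_swap]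
        exact ((hwm.comp_snd).mul hDm.enorm.aemeasurable).pow_const 2
    _ ≤ _ := by
        refine mul_le_mul_right (setLIntegral_mono' measurableSet_Icc fun t ht => ?_) _
        simp_rw [mul_pow]
        rw [lintegral_const_mul' _ _ (by simp [hw]), hqF, ← hw t]
        simp_rw [hD _ t ht]
        exact mul_le_mul_right (lintegral_comp_probabilityFlow_le (x₀ := x₀) hf hg hm hV hV0 hΦ
          hΦT ht fun y => ‖S y t - mixScore x₀ (m t) (V t) y‖ₑ ^ 2) _

end FlowComparison

theorem theorem1 {n : ℕ} {Ω : Type*} [MeasurableSpace Ω] (P : Measure Ω) [IsProbabilityMeasure P]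
    {ι : Type*} [Fintype ι] [Nonempty ι] (x₀ : ι → EuclideanSpace ℝ (Fin n))
    (ε T : ℝ) (hε : 0 < ε) (hεT : ε < T)
    (f g : ℝ → ℝ) (hf : ContinuousOn f (Icc 0 T)) (hg : ContinuousOn g (Icc 0 T))
    (hf_nonneg : ∀ t ∈ Icc 0 T, 0 ≤ f t) (hg_pos : ∀ t ∈ Icc 0 T, 0 < g t)
    -- the forward diffusion started from the discrete law, and its marginals
    (W : ℝ≥0 → Ω → EuclideanSpace ℝ (Fin n)) (X : ℝ → Ω → EuclideanSpace ℝ (Fin n))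
    (hX : IsForwardSolution P f g T (uniformDiscrete x₀) W X)
    (p : ℝ → Measure (EuclideanSpace ℝ (Fin n))) (hp : ∀ t ∈ Icc 0 T, p t = P.map (X t))
    -- the learned score, Lipschitz in space with constant `L t` at each time `t ∈ [ε, T]`
    (S : EuclideanSpace ℝ (Fin n) → ℝ → EuclideanSpace ℝ (Fin n))
    (hS : Measurable (fun z : EuclideanSpace ℝ (Fin n) × ℝ => S z.1 z.2))
    (L : ℝ → ℝ) (hL_cont : ContinuousOn L (Icc ε T))
    (hL_int : IntervalIntegrable L volume 0 ε)
    (hL : ∀ t ∈ Icc ε T, ∀ x y, ‖S x t - S y t‖ ≤ L t * ‖x - y‖)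
    -- the solution maps from time `T` back to time `ε`
    (Mot Mθ : EuclideanSpace ℝ (Fin n) → EuclideanSpace ℝ (Fin n))
    (hMot : IsSolutionMap (flowVelocity f g (fun x t => score (p t) x)) T ε Mot)
    (hMθ : IsSolutionMap (flowVelocity f g S) T ε Mθ)
    (qT : Measure (EuclideanSpace ℝ (Fin n))) (hqT : qT = p T) :
    eLpNorm (fun x => Mot x - Mθ x) 2 qT ≤
      ENNReal.ofReal (√((T - ε) / (2 * integratingFactor f g L ε ^ 2))) *
        scoreMatchingLoss p S (fun t => g t ^ 4 * integratingFactor f g L t ^ 2) ε T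
          ^ (1 / 2 : ℝ) := by
  have hT0 : 0 ≤ T := (hε.trans hεT).le
  have hεT' := hεT.le
  have hsub : Icc ε T ⊆ Icc 0 T := Icc_subset_Icc_left hε.le
  -- extend the coefficients continuously to the whole line, where they are easier to integrate
  set f' : ℝ → ℝ := IccExtend hT0 ((Icc 0 T).domRestrict f) with hf'
  set g' : ℝ → ℝ := IccExtend hT0 ((Icc 0 T).domRestrict g) with hg'
  have hfc : Continuous f' := hf.domRestrict.Icc_extend'
  have hgc : Continuous g' := hg.domRestrict.Icc_extend'
  have hff : ∀ t ∈ Icc 0 T, f t = f' t := fun t ht => by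
    rw [hf', IccExtend_of_mem hT0 _ ht, domRestrict_apply]
  have hgg : ∀ t ∈ Icc 0 T, g t = g' t := fun t ht => by
    rw [hg', IccExtend_of_mem hT0 _ ht, domRestrict_apply]
  have hg'0 : ∀ t, 0 < g' t := fun t => hg_pos _ (projIcc 0 T hT0 t).2
  set m := meanScale f'
  set V := noiseVar f' g'
  have hV0 : ∀ t ∈ Icc ε T, 0 < V t := fun t ht =>
    noiseVar_pos hfc hgc hg'0 (hε.trans_le ht.1)
  set sc : EuclideanSpace ℝ (Fin n) → ℝ → EuclideanSpace ℝ (Fin n) :=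
    fun x t => mixScore x₀ (m t) (V t) x
  -- the marginals of the diffusion are Gaussian mixtures
  have hdens : ∀ t ∈ Icc ε T, IsContinuousDensity (p t) (mixDensity x₀ (m t) (V t)) := by
    intro t ht
    rw [hp t (hsub ht)]
    exact isContinuousDensity_mixDensity (hV0 t ht)
      ((hX.congr hff hgg).charFun_map hfc hgc (hsub ht))
  have hfin : ∀ t ∈ Icc ε T, IsFiniteMeasure (p t) := fun t ht => by
    rw [hp t (hsub ht)]; infer_instance
  have hscore : ∀ t ∈ Icc ε T, ∀ x, score (p t) x = sc x t := by
    intro t ht x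
    have := hfin t ht
    rw [score, continuousDensity_eq (hdens t ht)]
    exact (hasGradientAt_log_mixDensity (hV0 t ht) x).gradient
  have hlint : ∀ t ∈ Icc ε T, ∀ F : EuclideanSpace ℝ (Fin n) → ℝ≥0∞,
      ∫⁻ x, F x ∂(p t) = ∫⁻ x, F x * ENNReal.ofReal (mixDensity x₀ (m t) (V t) x) := by
    intro t ht F
    rw [(hdens t ht).2.2, lintegral_withDensity_eq_lintegral_mul_non_measurable _
      (hdens t ht).1.measurable.ennreal_ofReal (by simp)]
    simp only [Pi.mul_apply, mul_comm]
  -- in dimension zero `L` may be negative, but then there is nothing to prove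
  rcases subsingleton_or_nontrivial (EuclideanSpace ℝ (Fin n)) with hss | hnt
  · have : (fun x => Mot x - Mθ x) = 0 := Subsingleton.elim _ _
    rw [this, eLpNorm_zero]
    exact zero_le
  have hL0 : ∀ t ∈ Icc ε T, 0 ≤ L t := by
    intro t ht
    obtain ⟨x, y, hxy⟩ := exists_pair_ne (EuclideanSpace ℝ (Fin n))
    exact nonneg_of_mul_nonneg_left ((norm_nonneg _).trans (hL t ht x y))
      (norm_pos_iff.2 (sub_ne_zero.2 hxy))
  -- the integrating factor only depends on the coefficients on `[0, T]`
  set I := integratingFactor f' g' L with hI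
  have hII : ∀ t ∈ Icc ε T, integratingFactor f g L t = I t := by
    intro t ht
    rw [hI, integratingFactor, integratingFactor]
    congr 1
    refine intervalIntegral.integral_congr fun r hr => ?_
    rw [uIcc_of_le (hε.le.trans ht.1)] at hr
    have hr' : r ∈ Icc 0 T := ⟨hr.1, hr.2.trans ht.2⟩
    simp only [hff r hr', hgg r hr']
  have hI0 : ∀ t, 0 < I t := fun t => Real.exp_pos _
  have hIc : ContinuousOn I (Icc ε T) :=
    continuousOn_integratingFactor hε hεT hfc hgc hL_cont hL_int
  choose Φ hΦ hΦT hΦε using hMot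
  choose Ψ hΨ hΨT hΨε using hMθ
  have hΦ' : ∀ x, IsIntegralCurveOn (Φ x) (flowVelocity f' g' sc) (Icc ε T) := fun x => by
    rw [← uIcc_of_ge hεT']
    refine (hΦ x).congr_velocity fun t ht y => ?_
    rw [uIcc_of_ge hεT'] at ht
    rw [flowVelocity, flowVelocity, hff t (hsub ht), hgg t (hsub ht), hscore t ht]
  have hΨ' : ∀ x, IsIntegralCurveOn (Ψ x) (flowVelocity f' g' S) (Icc ε T) := fun x => by
    rw [← uIcc_of_ge hεT']
    refine (hΨ x).congr_velocity fun t ht y => ?_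
    rw [uIcc_of_ge hεT'] at ht
    rw [flowVelocity, flowVelocity, hff t (hsub ht), hgg t (hsub ht)]
  have hTmem : T ∈ Icc ε T := ⟨hεT', le_rfl⟩
  have hεmem : ε ∈ Icc ε T := ⟨le_rfl, hεT'⟩
  set A := ∫⁻ x, ‖Mot x - Mθ x‖ₑ ^ 2 ∂(p T) with hA
  set J := scoreMatchingLoss p S (fun t => g t ^ 4 * integratingFactor f g L t ^ 2) ε T with hJ
  have hmain : ENNReal.ofReal (I ε) ^ 2 * A ≤
      ENNReal.ofReal (T - ε) * (ENNReal.ofReal 2⁻¹ * J) := by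
    rw [hA, hlint T hTmem]
    simp_rw [hΦε, hΨε]
    refine (lintegral_sq_enorm_flow_sub_le hεT' hfc hgc (hasDerivAt_meanScale hfc)
      (hasDerivAt_noiseVar hfc hgc) hV0 (fun t ht => hff t (hsub ht) ▸ hf_nonneg t (hsub ht))
      hS hL0 hL hI0 hIc (fun t ht => hasDerivAt_integratingFactor hε hεT hfc hgc hL_cont hL_int ht)
      hΦ' hΦT hΨ' hΨT).trans_eq ?_
    have hloss : ∀ t ∈ Icc ε T, ENNReal.ofReal (g' t ^ 2 / 2 * I t) ^ 2 *
        ∫⁻ x, ‖S x t - sc x t‖ₑ ^ 2 * ENNReal.ofReal (mixDensity x₀ (m t) (V t) x) =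
        ENNReal.ofReal 4⁻¹ * (ENNReal.ofReal (g t ^ 4 * integratingFactor f g L t ^ 2) *
          ∫⁻ x, ‖S x t - score (p t) x‖ₑ ^ 2 ∂(p t)) := by
      intro t ht
      have := hI0 t
      simp_rw [hscore t ht]
      rw [hlint t ht, ← mul_assoc, ← ENNReal.ofReal_pow (by positivity),
        ← ENNReal.ofReal_mul (by positivity), hgg t (hsub ht), hII t ht]
      congr 2
      ring
    rw [setLIntegral_congr_fun measurableSet_Icc hloss, lintegral_const_mul' _ _ (by simp), hJ,
      scoreMatchingLoss, ← mul_assoc _ (2⁻¹ : ℝ≥0∞)]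
    congr 2
    rw [← ENNReal.ofReal_ofNat 2, ← ENNReal.ofReal_inv_of_pos two_pos,
      ← ENNReal.ofReal_mul (by positivity)]
    norm_num
  have hAJ : A ≤ ENNReal.ofReal ((T - ε) / (2 * I ε ^ 2)) * J := by
    have hIε := hI0 ε
    have hTε : 0 ≤ T - ε := by linarith
    calc A = ENNReal.ofReal (I ε ^ 2)⁻¹ * (ENNReal.ofReal (I ε) ^ 2 * A) := by
          rw [← mul_assoc, ← ENNReal.ofReal_pow hIε.le, ← ENNReal.ofReal_mul (by positivity),
            inv_mul_cancel₀ (by positivity), ENNReal.ofReal_one, one_mul]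
      _ ≤ ENNReal.ofReal (I ε ^ 2)⁻¹ * (ENNReal.ofReal (T - ε) * (ENNReal.ofReal 2⁻¹ * J)) := by
          gcongr
      _ = _ := by
          rw [← mul_assoc, ← mul_assoc, ← ENNReal.ofReal_mul (by positivity),
            ← ENNReal.ofReal_mul (by positivity)]
          congr 2
          field_simp
  rw [hqT, hII ε hεmem, eLpNorm_eq_lintegral_rpow_enorm_toReal two_ne_zero ENNReal.ofNat_ne_top]
  simp only [ENNReal.toReal_ofNat, ENNReal.rpow_ofNat]
  rw [← hA, Real.sqrt_eq_rpow, ← ENNReal.ofReal_rpow_of_nonneg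
    (div_nonneg (by linarith) (by positivity)) (by norm_num),
    ← ENNReal.mul_rpow_of_nonneg _ _ (by norm_num)]
  exact ENNReal.rpow_le_rpow hAJ (by norm_num)
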